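/- Fix a set $AP$ and the alphabet $\Sigma=2^{AP}$. An $\omega$-automaton $\mathcal A=(Q,q_0,\delta,\alpha)$ has a finite state set $Q$, an initial state $q_0$, a complete transition function $\delta:Q\times\Sigma\to 2^Q\setminus\{\emptyset\}$ and a Büchi, co-Büchi, Rabin or Streett acceptance condition $\alpha$; $L(\mathcal A)\subseteq\Sigma^\omega$ is its language. A finite MDP $\mathcal M=(S,\mathrm{Act},\mathsf P,s_0,L)$, with labelling $L:S\to\Sigma$, has a nonempty set $\mathrm{Act}(s)$ of enabled actions in each state; strategies may be history-dependent and randomised. A Markov chain is a finite MDP in which every state has exactly one enabled action. The product $\mathcal M\times\mathcal A$ has states $S\times Q$ and initial state $(s_0,q_0)$; in $(s,q)$ the enabled actions are the $(a,q')$ with $a\in\mathrm{Act}(s)$ and $q'\in\delta(q,L(s))$, and such an action leads to $(s',q')$ with probability $\mathsf P(s,a,s')$; a path is accepting if its sequence of $Q$-components satisfies $\alpha$. $\mathcal A$ is good for MDPs (GFM) if for every finite MDP $\mathcal M$ $$\sup_\sigma \mathbb P_{\mathcal M^\sigma}\{\xi: L(\xi)\in L(\mathcal A)\}=\sup_\sigma\mathbb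 P_{(\mathcal M\times\mathcal A)^\sigma}\{\xi:\xi\text{ is accepting}\},$$ where the suprema range over the strategies of $\mathcal M$ and of $\mathcal M\times\mathcal A$, respectively. An accepting end-component (AEC) of $\mathcal M\times\mathcal A$ is an end-component $E$ (a nonempty set of states, each with a nonempty set of enabled actions, closed under probabilistic transitions and strongly connected) that contains an infinite run which visits all states and transitions of $E$ infinitely often and is accepting. For a Markov chain $\mathcal M$ and automata $\mathcal A,\mathcal B$ over $\Sigma$, consider the following game. Spoiler produces an infinite path $\xi$ of $\mathcal M\times\mathcal A$ from its initial state (all transitions having positive probability) and, at most once, at some time $k$, makes an AEC claim: she names an end-component $E$ of $\mathcal M\times\mathcal A$, thereby announcing the list of all finite sequences of consecutive transitions of $E$. Duplicator produces an infinite path $\zeta$ of $\mathcal M\times\mathcal B$ from its initial state, over the same path of $\mathcal M$. The path $\xi$ complies with the claim if $E$ is an AEC, the state of $\xi$ at time $k$ belongs to $E$, and the finite sequences of transitions that occur infinitely often in $\xi$ are exactly those on the list. Duplicator wins if Spoiler makes no claim, or $\zeta$ is accepting, or $\xi$ does not comply with the claim, or $\xi$ is not accepting. A strategy $\sigma$ on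 $\mathcal M\times\mathcal B$ AEC-simulates $\mathcal M\times\mathcal A$ if Duplicator wins every play in which each action of $\zeta$ has positive probability under $\sigma$, given the history of $\zeta$. **Theorem.** Let $\mathcal A$ and $\mathcal B$ be GFM automata with $L(\mathcal A)=L(\mathcal B)$. For every Markov chain $\mathcal M$ there is a strategy $\sigma$ on $\mathcal M\times\mathcal B$ that AEC-simulates $\mathcal M\times\mathcal A$. -/

import Mathlib

open Filter MeasureTheory ProbabilityTheory

noncomputable section

namespace GFM

/-! ### Automata over infinite words -/

/-- The set of elements that occur infinitely often in an infinite sequence. -/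
def infSet {X : Type} (ρ : ℕ → X) : Set X := {x | ∃ᶠ n in atTop, ρ n = x}

/-- Acceptance conditions over a set `X` of states. A Rabin or Streett condition is a finite
family of pairs `(B i, G i)`. -/
inductive Acceptance (X : Type) : Type
  | buchi (F : Set X) : Acceptance X
  | coBuchi (F : Set X) : Acceptance X
  | rabin (k : ℕ) (B G : Fin k → Set X) : Acceptance X
  | streett (k : ℕ) (B G : Fin k → Set X) : Acceptance X

/-- The sequence `ρ` of states satisfies the acceptance condition. -/
def Acceptance.Sat {X : Type} : Acceptance X → (ℕ → X) → Prop
  | .buchi F, ρ => (infSet ρ ∩ F).Nonempty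
  | .coBuchi F, ρ => infSet ρ ∩ F = ∅
  | .rabin _ B G, ρ => ∃ i, (infSet ρ ∩ G i).Nonempty ∧ infSet ρ ∩ B i = ∅
  | .streett _ B G, ρ => ∀ i, (infSet ρ ∩ G i).Nonempty ∨ infSet ρ ∩ B i = ∅

/-- The acceptance condition on `Y` whose sets are the preimages under `f : Y → X`. -/
def Acceptance.comap {X Y : Type} (f : Y → X) : Acceptance X → Acceptance Y
  | .buchi F => .buchi (f ⁻¹' F)
  | .coBuchi F => .coBuchi (f ⁻¹' F)
  | .rabin k B G => .rabin k (fun i => f ⁻¹' B i) (fun i => f ⁻¹' G i)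
  | .streett k B G => .streett k (fun i => f ⁻¹' B i) (fun i => f ⁻¹' G i)

/-- A complete nondeterministic `ω`-automaton with state set `Q` over the alphabet `2^AP`. -/
structure Automaton (AP Q : Type) where
  init : Q
  δ : Q → Set AP → Set Q
  complete : ∀ q a, (δ q a).Nonempty
  acc : Acceptance Q

/-- `ρ` is a run of the automaton on the infinite word `w`. -/
def Automaton.IsRun {AP Q : Type} (A : Automaton AP Q) (w : ℕ → Set AP) (ρ : ℕ → Q) : Prop :=
  ρ 0 = A.init ∧ ∀ n, ρ (n + 1) ∈ A.δ (ρ n) (w n)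

/-- The `ω`-language of the automaton. -/
def Automaton.language {AP Q : Type} (A : Automaton AP Q) : Set (ℕ → Set AP) :=
  {w | ∃ ρ, A.IsRun w ρ ∧ A.acc.Sat ρ}

/-! ### Markov decision processes -/

/-- A labelled Markov decision process. `act s` is the (nonempty) set of actions enabled in `s`,
and `P s a` is the successor distribution for an enabled action `a` of `s`
(for an action that is not enabled the value `P s a` is never used). -/
structure MDP (AP S Act : Type) where
  init : S
  act : S → Set Act
  act_nonempty : ∀ s, (act s).Nonempty
  P : S → Act → PMF S
  label : S → Set AP

/-- A Markov chain is an MDP without nondeterminism: exactly one action is enabled per state. -/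
def MDP.IsMarkovChain {AP S Act : Type} (M : MDP AP S Act) : Prop := ∀ s, ∃! a, a ∈ M.act s

/-- A state of an MDP together with the action chosen there. -/
structure Step (S Act : Type) where
  state : S
  action : Act

instance {S Act : Type} : MeasurableSpace (Step S Act) := ⊤

instance {S Act : Type} : DiscreteMeasurableSpace (Step S Act) := ⟨fun _ => trivial⟩

instance {S Act : Type} [Finite S] [Finite Act] : Finite (Step S Act) :=
  Finite.of_injective (fun x : Step S Act => (x.state, x.action)) (by
    rintro ⟨s, a⟩ ⟨t, b⟩ h
    simpa using h)

namespace MDP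

variable {AP S Act : Type}

/-- `ξ`, read as `s₀ a₀ s₁ a₁ …`, is an infinite path of `M` from the initial state. -/
def IsPath (M : MDP AP S Act) (ξ : ℕ → Step S Act) : Prop :=
  (ξ 0).state = M.init ∧
    ∀ n, (ξ n).action ∈ M.act (ξ n).state ∧
      (ξ (n + 1)).state ∈ (M.P (ξ n).state (ξ n).action).support

/-- The trace `L(s₀) L(s₁) …` of `s₀ a₀ s₁ a₁ …`. -/
def trace (M : MDP AP S Act) (ξ : ℕ → Step S Act) : ℕ → Set AP := fun n => M.label (ξ n).state

/-- A (history-dependent, randomised) strategy. The finite path `s₀ a₀ … sₙ₋₁ aₙ₋₁ sₙ` is given as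
the list `[(s₀, a₀), …, (sₙ₋₁, aₙ₋₁)]` together with its last state `sₙ`. -/
structure Strategy (M : MDP AP S Act) where
  choice : List (Step S Act) → S → PMF Act
  enabled : ∀ h s a, a ∈ (choice h s).support → a ∈ M.act s

/-- The law of the step `(s', a)` when `s'` is drawn from `p` and then `a` is drawn by the
strategy after the history `h` and `s'`. -/
def Strategy.nextStep {M : MDP AP S Act} (σ : M.Strategy) (h : List (Step S Act)) (p : PMF S) :
    PMF (Step S Act) :=
  p.bind fun s' => (σ.choice h s').map fun a => ⟨s', a⟩

/-- The transition kernels of the Markov chain induced by the strategy. -/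
def Strategy.kernel {M : MDP AP S Act} [Finite S] [Finite Act] (σ : M.Strategy) (n : ℕ) :
    Kernel (∀ _ : Finset.Iic n, Step S Act) (Step S Act) :=
  Kernel.ofFunOfCountable fun x =>
    let last := x ⟨n, Finset.mem_Iic.2 le_rfl⟩
    let h := List.ofFn fun i : Fin (n + 1) => x ⟨i, Finset.mem_Iic.2 (Nat.lt_succ_iff.1 i.2)⟩
    (σ.nextStep h (M.P last.state last.action)).toMeasure

instance {M : MDP AP S Act} [Finite S] [Finite Act] (σ : M.Strategy) (n : ℕ) :
    IsMarkovKernel (σ.kernel n) :=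
  ⟨fun x => by
    simp only [Strategy.kernel, Kernel.ofFunOfCountable, Kernel.coe_mk]
    infer_instance⟩

/-- The probability measure on infinite paths induced by the strategy and the initial state. -/
def Strategy.pathMeasure {M : MDP AP S Act} [Finite S] [Finite Act] (σ : M.Strategy) :
    Measure (ℕ → Step S Act) :=
  Kernel.trajMeasure (X := fun _ => Step S Act)
    (σ.nextStep [] (PMF.pure M.init)).toMeasure σ.kernel

/-- The infinite path `ξ` is a possible outcome of the strategy: every action in it is chosen by
the strategy with positive probability. -/
def Strategy.Consistent {M : MDP AP S Act} (σ : M.Strategy) (ξ : ℕ → Step S Act) : Prop :=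
  ∀ n, (ξ n).action ∈ (σ.choice (List.ofFn fun i : Fin n => ξ i) (ξ n).state).support

/-- The product of an MDP with an automaton: the successor state of the automaton is part of the
action. -/
def product {Q : Type} (M : MDP AP S Act) (A : Automaton AP Q) : MDP AP (S × Q) (Act × Q) where
  init := (M.init, A.init)
  act x := {b | b.1 ∈ M.act x.1 ∧ b.2 ∈ A.δ x.2 (M.label x.1)}
  act_nonempty x := by
    obtain ⟨a, ha⟩ := M.act_nonempty x.1
    obtain ⟨q, hq⟩ := A.complete x.2 (M.label x.1)
    exact ⟨(a, q), ha, hq⟩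
  P x b := (M.P x.1 b.1).map fun s' => (s', b.2)
  label x := M.label x.1

end MDP

/-- The acceptance condition `α×` of the product `M × A`. -/
def prodAcc {AP Q : Type} (S : Type) (A : Automaton AP Q) : Acceptance (S × Q) :=
  A.acc.comap Prod.snd

/-- A path of `M × A` is accepting if its sequence of states satisfies `α×`. -/
def AcceptingPath {AP S Act Q : Type} (A : Automaton AP Q) (ξ : ℕ → Step (S × Q) (Act × Q)) :
    Prop :=
  (prodAcc S A).Sat fun n => (ξ n).state

/-- Maximal semantic satisfaction probability. -/
def Psem {AP S Act Q : Type} [Finite S] [Finite Act] (M : MDP AP S Act) (A : Automaton AP Q) :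
    ENNReal :=
  ⨆ σ : M.Strategy, σ.pathMeasure {ξ | M.trace ξ ∈ A.language}

/-- Maximal syntactic satisfaction probability. -/
def Psyn {AP S Act Q : Type} [Finite S] [Finite Act] [Finite Q] (M : MDP AP S Act)
    (A : Automaton AP Q) : ENNReal :=
  ⨆ σ : (M.product A).Strategy, σ.pathMeasure {ξ | AcceptingPath A ξ}

/-- An automaton is good for MDPs if semantic and syntactic satisfaction probabilities agree on
all finite MDPs. -/
def Automaton.IsGFM {AP Q : Type} [Finite Q] (A : Automaton AP Q) : Prop :=
  ∀ (S Act : Type) [Finite S] [Finite Act] (M : MDP AP S Act), Psem M A = Psyn M A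

/-! ### End-components and the AEC-simulation game -/

/-- An end-component of an MDP: a nonempty set of states with a nonempty set of enabled actions
for each of them, closed under probabilistic transitions, with a strongly connected graph. -/
structure EndComponent {AP S Act : Type} (M : MDP AP S Act) where
  states : Set S
  acts : S → Set Act
  nonempty : states.Nonempty
  acts_subset : ∀ s ∈ states, acts s ⊆ M.act s
  acts_nonempty : ∀ s ∈ states, (acts s).Nonempty
  closed : ∀ s ∈ states, ∀ a ∈ acts s, (M.P s a).support ⊆ states
  connected : ∀ s ∈ states, ∀ t ∈ states,
    Relation.ReflTransGen
      (fun x y => x ∈ states ∧ ∃ a ∈ acts x, y ∈ (M.P x a).support) s t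

/-- A transition `(s, a, s')`. -/
abbrev Transition (S Act : Type) : Type := S × Act × S

/-- The `n`-th transition of an infinite path. -/
def transitionAt {S Act : Type} (ξ : ℕ → Step S Act) (n : ℕ) : Transition S Act :=
  ((ξ n).state, (ξ n).action, (ξ (n + 1)).state)

/-- The finite sequence `u` of transitions occurs in `ξ` at position `n`. -/
def OccursAt {S Act : Type} (ξ : ℕ → Step S Act) (u : List (Transition S Act)) (n : ℕ) : Prop :=
  ∀ i (h : i < u.length), u[i] = transitionAt ξ (n + i)

/-- The finite sequences of transitions that occur infinitely often in `ξ`. -/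
def infSequences {S Act : Type} (ξ : ℕ → Step S Act) : Set (List (Transition S Act)) :=
  {u | ∃ᶠ n in atTop, OccursAt ξ u n}

namespace EndComponent

variable {AP S Act : Type} {M : MDP AP S Act}

/-- The transitions of an end-component. -/
def transitions (E : EndComponent M) : Set (Transition S Act) :=
  {t | t.1 ∈ E.states ∧ t.2.1 ∈ E.acts t.1 ∧ t.2.2 ∈ (M.P t.1 t.2.1).support}

/-- The complete list of all finite sequences of consecutive transitions of an end-component. -/
def sequences (E : EndComponent M) : Set (List (Transition S Act)) :=
  {u | (∀ t ∈ u, t ∈ E.transitions) ∧ u.IsChain fun t t' => t.2.2 = t'.1}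

/-- An end-component is accepting for `α` if it contains an infinite run that visits all its
states and transitions (infinitely often) and satisfies `α`. -/
def IsAccepting (E : EndComponent M) (α : Acceptance S) : Prop :=
  ∃ ξ : ℕ → Step S Act, (∀ n, transitionAt ξ n ∈ E.transitions) ∧
    (∀ t ∈ E.transitions, ∃ᶠ n in atTop, transitionAt ξ n = t) ∧
    α.Sat fun n => (ξ n).state

end EndComponent

variable {AP S Act QA QB : Type}

/-- An AEC claim of Spoiler: the time of the claim and the end-component of `M × A` claimed to
have been reached. The list of transition sequences that is announced with it, and that is never
updated, is the complete list `E.sequences` of this end-component. -/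
abbrev AECClaim (M : MDP AP S Act) (A : Automaton AP QA) : Type := ℕ × EndComponent (M.product A)

/-- Spoiler's path `ξ` complies with her AEC claim `(k, E)`: `E` is an accepting end-component, the
path is in `E` at time `k`, and the transition sequences that occur infinitely often are exactly
the ones on the announced list. -/
def Complies {M : MDP AP S Act} {A : Automaton AP QA} (ξ : ℕ → Step (S × QA) (Act × QA))
    (c : AECClaim M A) : Prop :=
  c.2.IsAccepting (prodAcc S A) ∧ (ξ c.1).state ∈ c.2.states ∧ infSequences ξ = c.2.sequences

/-- The winning condition of Duplicator, for Spoiler's path `ξ` of `M × A`, Spoiler's claim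
(`none` if she never makes one) and Duplicator's path `ζ` of `M × B`. -/
def DuplicatorWins {M : MDP AP S Act} {A : Automaton AP QA} (B : Automaton AP QB)
    (ξ : ℕ → Step (S × QA) (Act × QA)) (claim : Option (AECClaim M A))
    (ζ : ℕ → Step (S × QB) (Act × QB)) : Prop :=
  claim = none ∨ AcceptingPath B ζ ∨ (∃ c, claim = some c ∧ ¬ Complies ξ c) ∨ ¬ AcceptingPath A ξ

/-- The two paths, of `M × A` and of `M × B`, project to the same path of `M`. -/
def SameBasePath (ξ : ℕ → Step (S × QA) (Act × QA)) (ζ : ℕ → Step (S × QB) (Act × QB)) : Prop :=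
  ∀ n, (ζ n).state.1 = (ξ n).state.1 ∧ (ζ n).action.1 = (ξ n).action.1

/-- The strategy `σ` on `M × B` AEC-simulates `M × A` (for a Markov chain `M`): in the game where
Spoiler moves along a path of `M × A`, with at most one AEC claim, and Duplicator moves along
the same path of `M` in `M × B`, choosing the transitions of `B` by `σ`, every play is won by
Duplicator. -/
def AECSimulates (M : MDP AP S Act) (A : Automaton AP QA) (B : Automaton AP QB)
    (σ : (M.product B).Strategy) : Prop :=
  ∀ (ξ : ℕ → Step (S × QA) (Act × QA)) (claim : Option (AECClaim M A))
    (ζ : ℕ → Step (S × QB) (Act × QB)),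
    (M.product A).IsPath ξ → (M.product B).IsPath ζ → SameBasePath ξ ζ → σ.Consistent ζ →
      DuplicatorWins B ξ claim ζ

end GFM

end

/-! A claim of Spoiler can only matter if her path visits an accepting end-component (AEC) and all
finite sequences of transitions of that component recur. Two consequences concern the base path in
`M` alone. First, it is generic: after infinitely many visits to any recurrent state it follows each
finite path of the graph of `M` that starts there. Second, the subset construction of `A` along it
stays in promising pairs, those from which a pair containing a state of an AEC of `M × A` can be
reached. Duplicator can therefore ignore the claim and win on all such base paths.

Let `M.pruned A` be `M` with the subset construction, restricted to promising pairs. It is again a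
Markov chain, and almost every trace of it lies in `L(A)` (`trace_pruned_mem_language`), hence in
`L(B)`. Since `B` is good for MDPs, the acceptance probabilities in `M.pruned A × B` have supremum 1
(`exists_region_pruned`). A potential argument turns this into a region in which an AEC of this
product can be reached without any risk of leaving the region (`exists_region_of_iSup_eq_one`).

Probability then disappears. A deterministic strategy that heads for an AEC and afterwards visits
its states in turn succeeds on every generic base path, because such a path contains synchronizing
words that force each target (`exists_winning_phaseStrategy`). Its choices are copied to `M × B`,
with the subset construction of `A` as additional memory (`acceptingPath_of_consistent`). -/

noncomputable section

namespace GFM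

/-! ### The path measure -/

namespace MDP

variable {AP X Act : Type} {N : MDP AP X Act}

theorem Strategy.mem_support_nextStep (σ : N.Strategy) (h : List (Step X Act)) (p : PMF X)
    (x : Step X Act) :
    x ∈ (σ.nextStep h p).support ↔
      x.state ∈ p.support ∧ x.action ∈ (σ.choice h x.state).support := by
  obtain ⟨s, a⟩ := x
  simp only [Strategy.nextStep, PMF.mem_support_bind_iff, PMF.support_map, Set.mem_image]
  constructor
  · rintro ⟨s', hs', a', ha', h⟩
    cases h
    exact ⟨hs', ha'⟩
  · rintro ⟨h1, h2⟩
    exact ⟨s, h1, a, h2, rfl⟩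

theorem Strategy.map_state_nextStep (σ : N.Strategy) (h : List (Step X Act)) (p : PMF X) :
    (σ.nextStep h p).map Step.state = p := by
  simp only [Strategy.nextStep, PMF.map_bind, PMF.map_comp]
  have : ∀ s : X, (PMF.map (Step.state ∘ fun a : Act => (⟨s, a⟩ : Step X Act)) (σ.choice h s))
      = PMF.pure s := fun s => PMF.map_const _ s
  simp only [this, PMF.bind_pure]

theorem lintegral_toMeasure_map {α β : Type} [MeasurableSpace α] [DiscreteMeasurableSpace α]
    [Finite β] (p : PMF α) (f : α → β) (φ : β → ENNReal) :
    ∫⁻ x, φ (f x) ∂p.toMeasure = ∑' y, p.map f y * φ y := by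
  let _ : MeasurableSpace β := ⊤
  have : DiscreteMeasurableSpace β := ⟨fun _ => trivial⟩
  rw [← lintegral_map (μ := p.toMeasure) (f := φ) (g := f) (Measurable.of_discrete) (Measurable.of_discrete),
    PMF.toMeasure_map _ _ (Measurable.of_discrete), lintegral_countable']
  refine tsum_congr fun y => ?_
  rw [PMF.toMeasure_apply_singleton _ _ (MeasurableSet.of_discrete), mul_comm]

theorem Strategy.toMeasure_nextStep_state (σ : N.Strategy) (h : List (Step X Act)) (p : PMF X)
    (s : X) : (σ.nextStep h p).toMeasure {x | x.state = s} = p s := by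
  let _ : MeasurableSpace X := ⊤
  have : DiscreteMeasurableSpace X := ⟨fun _ => trivial⟩
  have h1 := PMF.toMeasure_map_apply Step.state (σ.nextStep h p) {s} (Measurable.of_discrete)
    (MeasurableSet.of_discrete)
  rw [map_state_nextStep, PMF.toMeasure_apply_singleton _ _ (MeasurableSet.of_discrete)] at h1
  exact h1.symm

/-- A set of infinite paths that depends only on the steps up to time `n`. -/
def DependsUpTo (n : ℕ) (D : Set (ℕ → Step X Act)) : Prop :=
  ∀ ω ω' : ℕ → Step X Act, (∀ i ≤ n, ω i = ω' i) → ω ∈ D → ω' ∈ D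

theorem DependsUpTo.exists_eq {n : ℕ} {D : Set (ℕ → Step X Act)} (hD : DependsUpTo n D) :
    ∃ D' : Set (∀ _ : Finset.Iic n, Step X Act), D = {ω : ℕ → Step X Act | Preorder.frestrictLe n ω ∈ D'} := by
  refine ⟨Preorder.frestrictLe (π := fun _ => Step X Act) n '' D, ?_⟩
  ext ω
  constructor
  · exact fun h => ⟨ω, h, rfl⟩
  · rintro ⟨ω', h', he⟩
    refine hD ω' ω (fun i hi => ?_) h'
    exact congrFun he ⟨i, Finset.mem_Iic.2 hi⟩

variable [Finite X] [Finite Act]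

instance (σ : N.Strategy) : IsProbabilityMeasure σ.pathMeasure := by
  unfold Strategy.pathMeasure
  infer_instance

/-- The history of an infinite path up to and including time `n`. -/
def historyUpTo (ω : ℕ → Step X Act) (n : ℕ) : List (Step X Act) :=
  List.ofFn fun i : Fin (n + 1) => ω i

/-- The joint law of the prefix up to `n` and the next step is the composition product of the prefix
law with the `n`-th kernel. The one-step estimates below rest on this disintegration. -/
theorem Strategy.lintegral_succ (σ : N.Strategy) (n : ℕ)
    (g : (∀ _ : Finset.Iic n, Step X Act) → Step X Act → ENNReal) :
    ∫⁻ ω, g (Preorder.frestrictLe n ω) (ω (n + 1)) ∂σ.pathMeasure =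
      ∫⁻ ω, ∫⁻ y, g (Preorder.frestrictLe n ω) y
        ∂(σ.nextStep (historyUpTo ω n) (N.P (ω n).state (ω n).action)).toMeasure
        ∂σ.pathMeasure := by
  have key := Kernel.map_frestrictLe_trajMeasure_compProd_eq_map_trajMeasure
    (X := fun _ => Step X Act) (μ₀ := (σ.nextStep [] (PMF.pure N.init)).toMeasure)
    (κ := σ.kernel) (a := n)
  have h1 : ∫⁻ ω, g (Preorder.frestrictLe n ω) (ω (n + 1)) ∂σ.pathMeasure
      = ∫⁻ z, g z.1 z.2 ∂(σ.pathMeasure.map fun x => (Preorder.frestrictLe n x, x (n + 1))) := by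
    rw [lintegral_map (Measurable.of_discrete) (by fun_prop)]
  rw [h1]
  unfold Strategy.pathMeasure
  rw [← key, Measure.lintegral_compProd (Measurable.of_discrete),
    lintegral_map (Measurable.of_discrete) (by fun_prop)]
  rfl

theorem Strategy.measure_inter_succ (σ : N.Strategy) (n : ℕ)
    (D : Set (∀ _ : Finset.Iic n, Step X Act)) (T : Set (Step X Act)) :
    σ.pathMeasure {ω : ℕ → Step X Act | Preorder.frestrictLe n ω ∈ D ∧ ω (n + 1) ∈ T} =
      ∫⁻ ω in {ω : ℕ → Step X Act | Preorder.frestrictLe n ω ∈ D},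
        (σ.nextStep (historyUpTo ω n) (N.P (ω n).state (ω n).action)).toMeasure T
        ∂σ.pathMeasure := by
  classical
  have hm : MeasurableSet {ω : ℕ → Step X Act | Preorder.frestrictLe n ω ∈ D} :=
    (MeasurableSet.of_discrete (s := D)).preimage (by fun_prop)
  have hT : MeasurableSet {ω : ℕ → Step X Act | ω (n + 1) ∈ T} :=
    (MeasurableSet.of_discrete (s := T)).preimage (by fun_prop)
  have h := σ.lintegral_succ n fun x y => D.indicator 1 x * T.indicator 1 y
  rw [← lintegral_indicator hm]
  have e : {ω : ℕ → Step X Act | Preorder.frestrictLe n ω ∈ D ∧ ω (n + 1) ∈ T} =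
    {ω : ℕ → Step X Act | Preorder.frestrictLe n ω ∈ D} ∩ {ω | ω (n + 1) ∈ T} := rfl
  rw [e, ← lintegral_indicator_one (hm.inter hT)]
  convert h using 1
  · refine lintegral_congr fun ω => ?_
    simp only [Set.indicator, Set.mem_inter_iff, Set.mem_ofPred_eq, Pi.one_apply]
    by_cases h1 : Preorder.frestrictLe n ω ∈ D <;> by_cases h2 : ω (n + 1) ∈ T <;> simp [h1, h2]
  · refine lintegral_congr fun ω => ?_
    by_cases h1 : Preorder.frestrictLe n ω ∈ D
    · simp only [Set.indicator, h1, Set.mem_ofPred_eq, if_true, Pi.one_apply, one_mul]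
      have := lintegral_indicator_one (μ := (σ.nextStep (historyUpTo ω n)
        (N.P (ω n).state (ω n).action)).toMeasure) (MeasurableSet.of_discrete (s := T))
      rw [← this]; rfl
    · simp [Set.indicator, h1]

theorem DependsUpTo.measurableSet {n : ℕ} {D : Set (ℕ → Step X Act)} (hD : DependsUpTo n D) :
    MeasurableSet D := by
  obtain ⟨D', rfl⟩ := hD.exists_eq
  have hr : Measurable (Preorder.frestrictLe (π := fun _ => Step X Act) n) := by fun_prop
  exact (MeasurableSet.of_discrete (s := D')).preimage hr

/-- If infinitely often the history allows the next step to lie in `T` with probability at least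
`p`, then almost surely the next step lies in `T` infinitely often at such times. -/
theorem Strategy.ae_frequently_succ (σ : N.Strategy) (D : ℕ → Set (ℕ → Step X Act))
    (hD : ∀ n, DependsUpTo n (D n)) (T : Set (Step X Act)) (p : ENNReal) (hp : p ≠ 0)
    (h : ∀ n, ∀ ω ∈ D n,
      p ≤ (σ.nextStep (historyUpTo ω n) (N.P (ω n).state (ω n).action)).toMeasure T) :
    ∀ᵐ ω ∂σ.pathMeasure, (∃ᶠ n in atTop, ω ∈ D n) →
      ∃ᶠ n in atTop, ω ∈ D n ∧ ω (n + 1) ∈ T := by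
  -- `F k n`: time `n` offers a chance, and no chance in `[k, n)` has succeeded. The events "`F k n`
  -- and success at `n`" are disjoint for different `n`, so `p * ∑ P(F k n) ≤ 1`, and Borel–Cantelli
  -- excludes infinitely many failures in a row.
  set F : ℕ → ℕ → Set (ℕ → Step X Act) := fun k n =>
    {ω | ω ∈ D n ∧ ∀ m < n, k ≤ m → ¬ (ω ∈ D m ∧ ω (m + 1) ∈ T)} with hF
  have hFl : ∀ k n, DependsUpTo n (F k n) := by
    intro k n ω ω' he hω
    refine ⟨hD n ω ω' he hω.1, fun m hm hkm hc => hω.2 m hm hkm ⟨?_, ?_⟩⟩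
    · exact hD m ω' ω (fun i hi => (he i (hi.trans hm.le)).symm) hc.1
    · rw [he (m + 1) hm]
      exact hc.2
  have hT : ∀ n, MeasurableSet {ω : ℕ → Step X Act | ω (n + 1) ∈ T} := fun n =>
    (MeasurableSet.of_discrete (s := T)).preimage (measurable_pi_apply (n + 1))
  have hle : ∀ k n, p * σ.pathMeasure (F k n) ≤
      σ.pathMeasure (F k n ∩ {ω | ω (n + 1) ∈ T}) := by
    intro k n
    obtain ⟨D', hD'⟩ := (hFl k n).exists_eq
    have := σ.measure_inter_succ n D' T
    have e : F k n ∩ {ω | ω (n + 1) ∈ T} =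
      {ω : ℕ → Step X Act | Preorder.frestrictLe n ω ∈ D' ∧ ω (n + 1) ∈ T} := by
      rw [hD']; rfl
    rw [e, this, ← hD', ← setLIntegral_const]
    exact setLIntegral_mono' (hFl k n).measurableSet fun ω hω => h n ω hω.1
  have hsum : ∀ k, ∑' n, σ.pathMeasure (F k (n + k)) ≠ ⊤ := by
    intro k
    have h1 : ∑' n, σ.pathMeasure (F k (n + k) ∩ {ω | ω (n + k + 1) ∈ T}) ≤
        σ.pathMeasure (⋃ n, F k (n + k) ∩ {ω | ω (n + k + 1) ∈ T}) := by
      refine tsum_meas_le_meas_iUnion_of_disjoint _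
        (fun n => (hFl k (n + k)).measurableSet.inter (hT _)) ?_
      have hlt : ∀ m n : ℕ, m < n → Disjoint (F k (m + k) ∩ {ω | ω (m + k + 1) ∈ T})
          (F k (n + k) ∩ {ω | ω (n + k + 1) ∈ T}) := fun m n hmn =>
        Set.disjoint_left.2 fun ω hm hn =>
          hn.1.2 (m + k) (by omega) (by omega) ⟨hm.1.1, hm.2⟩
      intro m n hmn
      rcases lt_or_gt_of_ne hmn with h | h
      · exact hlt m n h
      · exact (hlt n m h).symm
    have h2 : p * ∑' n, σ.pathMeasure (F k (n + k)) ≤ 1 := by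
      rw [← ENNReal.tsum_mul_left]
      exact ((ENNReal.tsum_le_tsum fun n => hle k (n + k)).trans h1).trans prob_le_one
    intro ht
    rw [ht, ENNReal.mul_top hp] at h2
    simp at h2
  have hae : ∀ k, ∀ᵐ ω ∂σ.pathMeasure, ¬ ∃ᶠ n in atTop, ω ∈ F k (n + k) := fun k =>
    measure_eq_zero_iff_ae_notMem.1 (measure_setOfPred_frequently_eq_zero (hsum k))
  filter_upwards [ae_all_iff.2 hae] with ω hω hfr
  by_contra hc
  rw [Filter.not_frequently, eventually_atTop] at hc
  obtain ⟨k, hk⟩ := hc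
  refine hω k ?_
  rw [frequently_atTop] at hfr ⊢
  intro a
  obtain ⟨b, hb, hbD⟩ := hfr (a + k)
  refine ⟨b - k, by omega, ?_⟩
  rw [Nat.sub_add_cancel (by omega)]
  exact ⟨hbD, fun m _ hkm => hk m hkm⟩

theorem Strategy.map_zero_pathMeasure (σ : N.Strategy) :
    σ.pathMeasure.map (fun ω => ω 0) = (σ.nextStep [] (PMF.pure N.init)).toMeasure := by
  unfold Strategy.pathMeasure Kernel.trajMeasure
  have e : (fun ω : ℕ → Step X Act => ω 0) =
      (fun x : (∀ _ : Finset.Iic 0, Step X Act) => x ⟨0, Finset.mem_Iic.2 le_rfl⟩) ∘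
        Preorder.frestrictLe (π := fun _ => Step X Act) 0 := rfl
  rw [e, ← Measure.map_map (Measurable.of_discrete) (by fun_prop),
    Measure.map_comp _ _ (by fun_prop), Kernel.traj_map_frestrictLe, Kernel.partialTraj_self,
    Measure.id_comp, Measure.map_map (Measurable.of_discrete) (by fun_prop)]
  exact Measure.map_id

theorem Strategy.ae_zero (σ : N.Strategy) :
    ∀ᵐ ω ∂σ.pathMeasure, (ω 0).state = N.init ∧ (ω 0).action ∈ N.act (ω 0).state := by
  have h : ∀ᵐ x ∂(σ.nextStep [] (PMF.pure N.init)).toMeasure,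
      x.state = N.init ∧ x.action ∈ N.act x.state := by
    rw [ae_iff, PMF.toMeasure_apply_eq_zero_iff _ MeasurableSet.of_discrete]
    refine Set.disjoint_left.2 fun x hx hn => hn ?_
    rw [mem_support_nextStep] at hx
    refine ⟨by simpa using hx.1, σ.enabled _ _ _ hx.2⟩
  rw [← σ.map_zero_pathMeasure] at h
  exact ae_of_ae_map (measurable_pi_apply 0).aemeasurable h

theorem Strategy.ae_succ (σ : N.Strategy) (n : ℕ) :
    ∀ᵐ ω ∂σ.pathMeasure, (ω (n + 1)).state ∈ (N.P (ω n).state (ω n).action).support ∧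
      (ω (n + 1)).action ∈ N.act (ω (n + 1)).state := by
  classical
  have h := σ.lintegral_succ n fun x y =>
    if y.state ∈ (N.P (x ⟨n, Finset.mem_Iic.2 le_rfl⟩).state
      (x ⟨n, Finset.mem_Iic.2 le_rfl⟩).action).support ∧ y.action ∈ N.act y.state then 0 else 1
  have h0 : ∀ ω : ℕ → Step X Act, ∫⁻ y, (if y.state ∈ (N.P (ω n).state (ω n).action).support ∧
      y.action ∈ N.act y.state then 0 else 1 : ENNReal)
        ∂(σ.nextStep (historyUpTo ω n) (N.P (ω n).state (ω n).action)).toMeasure = 0 := by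
    intro ω
    rw [lintegral_eq_zero_iff (Measurable.of_discrete), Filter.EventuallyEq, ae_iff,
      PMF.toMeasure_apply_eq_zero_iff _ MeasurableSet.of_discrete]
    refine Set.disjoint_left.2 fun x hx hn => hn ?_
    rw [mem_support_nextStep] at hx
    simp [hx.1, σ.enabled _ _ _ hx.2, -PMF.mem_support_iff]
  have h1 : ∫⁻ ω, (if (ω (n + 1)).state ∈ (N.P (ω n).state (ω n).action).support ∧
      (ω (n + 1)).action ∈ N.act (ω (n + 1)).state then 0 else 1 : ENNReal) ∂σ.pathMeasure = 0 :=
    h.trans ((lintegral_congr h0).trans (by simp))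
  have hpair : Measurable fun ω : ℕ → Step X Act => (ω n, ω (n + 1)) := by fun_prop
  have hm : Measurable fun ω : ℕ → Step X Act =>
      (if (ω (n + 1)).state ∈ (N.P (ω n).state (ω n).action).support ∧
      (ω (n + 1)).action ∈ N.act (ω (n + 1)).state then 0 else 1 : ENNReal) :=
    (Measurable.of_discrete (f := fun z : Step X Act × Step X Act =>
      (if z.2.state ∈ (N.P z.1.state z.1.action).support ∧
        z.2.action ∈ N.act z.2.state then 0 else 1 : ENNReal))).comp hpair
  rw [lintegral_eq_zero_iff hm] at h1
  filter_upwards [h1] with ω hω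
  by_contra hc
  exact one_ne_zero ((if_neg hc).symm.trans hω)

theorem Strategy.ae_isPath (σ : N.Strategy) : ∀ᵐ ω ∂σ.pathMeasure, N.IsPath ω := by
  filter_upwards [σ.ae_zero, ae_all_iff.2 σ.ae_succ] with ω h0 h
  refine ⟨h0.1, fun n => ⟨?_, (h n).1⟩⟩
  cases n with
  | zero => exact h0.2
  | succ n => exact (h n).2

end MDP

/-! ### Accepting end-components and almost sure behaviour -/

theorem frequently_exists_of_finite {α β : Type} [Finite β] {l : Filter α} {p : α → β → Prop}
    (h : ∃ᶠ n in l, ∃ b, p n b) : ∃ b, ∃ᶠ n in l, p n b := by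
  by_contra hc
  simp only [not_exists, not_frequently] at hc
  refine h ?_
  filter_upwards [eventually_all.2 hc] with n hn
  simpa using hn

theorem eventually_frequently_eq {X : Type} [Finite X] (ρ : ℕ → X) :
    ∀ᶠ n in atTop, ∃ᶠ m in atTop, ρ m = ρ n := by
  have h : ∀ x : X, ∀ᶠ n in atTop, ρ n = x → ∃ᶠ m in atTop, ρ m = x := by
    intro x
    by_cases hx : ∃ᶠ m in atTop, ρ m = x
    · exact Eventually.of_forall fun _ _ => hx
    · rw [not_frequently] at hx
      filter_upwards [hx] with n hn h
      exact absurd h hn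
  filter_upwards [eventually_all.2 h] with n hn
  exact hn (ρ n) rfl

theorem infSet_nonempty {X : Type} [Finite X] (ρ : ℕ → X) : (infSet ρ).Nonempty := by
  obtain ⟨n, hn⟩ := (eventually_frequently_eq ρ).exists
  exact ⟨ρ n, hn⟩

theorem frequently_add_iff {p : ℕ → Prop} (k : ℕ) :
    (∃ᶠ n in atTop, p (n + k)) ↔ ∃ᶠ n in atTop, p n := by
  constructor
  · exact fun h => (tendsto_add_atTop_nat k).frequently h
  · intro h
    rw [frequently_atTop] at h ⊢
    intro a
    obtain ⟨b, hb, hp⟩ := h (a + k)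
    exact ⟨b - k, by omega, by rwa [Nat.sub_add_cancel (by omega)]⟩

theorem infSet_shift {X : Type} (ρ : ℕ → X) (k : ℕ) : infSet (fun n => ρ (n + k)) = infSet ρ := by
  ext x
  exact frequently_add_iff (p := fun n => ρ n = x) k

theorem infSet_comp {X Y : Type} [Finite Y] (f : Y → X) (ρ : ℕ → Y) :
    infSet (f ∘ ρ) = f '' infSet ρ := by
  ext x
  constructor
  · intro h
    have h' : ∃ᶠ n in atTop, ∃ y, ρ n = y ∧ f y = x :=
      Frequently.mono h fun n hn => ⟨ρ n, rfl, hn⟩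
    obtain ⟨y, hy⟩ := frequently_exists_of_finite h'
    exact ⟨y, hy.mono fun _ h => h.1, hy.exists.choose_spec.2⟩
  · rintro ⟨y, hy, rfl⟩
    exact Frequently.mono hy fun n hn => congrArg f hn

theorem Acceptance.sat_congr {X : Type} (α : Acceptance X) {ρ ρ' : ℕ → X}
    (h : infSet ρ = infSet ρ') : α.Sat ρ ↔ α.Sat ρ' := by
  cases α <;> simp only [Acceptance.Sat, h]

theorem Acceptance.sat_comap {X Y : Type} [Finite Y] (α : Acceptance X) (f : Y → X)
    (ρ : ℕ → Y) : (α.comap f).Sat ρ ↔ α.Sat (f ∘ ρ) := by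
  have hne : ∀ F : Set X, (infSet ρ ∩ f ⁻¹' F).Nonempty ↔ (infSet (f ∘ ρ) ∩ F).Nonempty := by
    intro F
    rw [infSet_comp, Set.image_inter_nonempty_iff]
  have he : ∀ F : Set X, infSet ρ ∩ f ⁻¹' F = ∅ ↔ infSet (f ∘ ρ) ∩ F = ∅ := by
    intro F
    rw [← Set.not_nonempty_iff_eq_empty, ← Set.not_nonempty_iff_eq_empty, hne]
  cases α <;> simp only [Acceptance.Sat, Acceptance.comap, hne, he]

variable {AP X Act : Type} {N : MDP AP X Act}

namespace EndComponent

/-- Acceptance depends only on the set of recurrent states, which is `E.states` for the witnessing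
run as well. -/
theorem IsAccepting.sat {E : EndComponent N} {α : Acceptance X} (hE : E.IsAccepting α)
    {ρ : ℕ → X} (hρ : infSet ρ = E.states) : α.Sat ρ := by
  obtain ⟨ξ, h1, h2, h3⟩ := hE
  refine (α.sat_congr ?_).1 h3
  rw [hρ]
  ext s
  constructor
  · intro hs
    obtain ⟨n, hn⟩ := Frequently.exists hs
    exact hn ▸ (h1 n).1
  · intro hs
    obtain ⟨a, ha⟩ := E.acts_nonempty s hs
    obtain ⟨t, ht⟩ := (N.P s a).support_nonempty
    exact Frequently.mono (h2 (s, a, t) ⟨hs, ha, ht⟩) fun n hn => congrArg Prod.fst hn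

end EndComponent

/-- The union of the accepting end-components. -/
def accStates (N : MDP AP X Act) (α : Acceptance X) : Set X :=
  {x | ∃ E : EndComponent N, E.IsAccepting α ∧ x ∈ E.states}

namespace MDP

/-- Every transition that is possible in a step taken infinitely often is itself taken infinitely
often. -/
def FairPath (N : MDP AP X Act) (ω : ℕ → Step X Act) : Prop :=
  ∀ (x : Step X Act), ∀ s ∈ (N.P x.state x.action).support, (∃ᶠ n in atTop, ω n = x) →
    ∃ᶠ n in atTop, ω n = x ∧ (ω (n + 1)).state = s

/-- The recurrent steps form the end-component. Fairness gives closure under probabilistic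
transitions; strong connectivity is read off a tail of the path on which only recurrent steps occur.
-/
theorem exists_endComponent [Finite X] [Finite Act] {ω : ℕ → Step X Act} (hp : N.IsPath ω)
    (hf : N.FairPath ω) : ∃ E : EndComponent N, E.states = infSet (fun n => (ω n).state) ∧
      (∀ᶠ n in atTop, transitionAt ω n ∈ E.transitions) ∧
      ∀ t ∈ E.transitions, ∃ᶠ n in atTop, transitionAt ω n = t := by
  have hev := eventually_frequently_eq ω
  have hst : ∀ {n}, (∃ᶠ m in atTop, ω m = ω n) → (ω n).state ∈ infSet fun n => (ω n).state :=
    fun h => Frequently.mono h fun m hm => congrArg Step.state hm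
  let E : EndComponent N :=
    { states := infSet (fun n => (ω n).state)
      acts := fun s => {a | ∃ᶠ n in atTop, ω n = ⟨s, a⟩}
      nonempty := infSet_nonempty _
      acts_subset := by
        intro s _ a ha
        obtain ⟨n, hn⟩ := Frequently.exists ha
        have := (hp.2 n).1
        rwa [hn] at this
      acts_nonempty := by
        intro s hs
        have h' : ∃ᶠ n in atTop, ∃ a, ω n = ⟨s, a⟩ :=
          Frequently.mono hs fun n hn => ⟨(ω n).action, by rw [← hn]⟩
        exact frequently_exists_of_finite h'
      closed := by
        intro s _ a ha t ht
        have h := hf ⟨s, a⟩ t ht ha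
        exact (frequently_add_iff (p := fun n => (ω n).state = t) 1).1 (h.mono fun n hn => hn.2)
      connected := by
        intro s hs t ht
        obtain ⟨n₀, hn₀⟩ := eventually_atTop.1 hev
        obtain ⟨n, hn, rfl⟩ := frequently_atTop.1 hs n₀
        obtain ⟨m, hm, rfl⟩ := frequently_atTop.1 ht n
        clear hs ht
        induction m, hm using Nat.le_induction with
        | base => exact Relation.ReflTransGen.refl
        | succ m hm ih =>
          refine ih.tail ⟨hst (hn₀ m (by omega)), (ω m).action, hn₀ m (by omega), (hp.2 m).2⟩ }
  refine ⟨E, rfl, ?_, ?_⟩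
  · filter_upwards [hev] with n hn
    exact ⟨hst hn, hn, (hp.2 n).2⟩
  · rintro ⟨s, a, t⟩ ⟨_, ha, ht⟩
    refine Frequently.mono (hf ⟨s, a⟩ t ht ha) fun n hn => ?_
    simp only [transitionAt]
    rw [hn.2, hn.1]

theorem eventually_mem_accStates [Finite X] [Finite Act] {ω : ℕ → Step X Act} (hp : N.IsPath ω)
    (hf : N.FairPath ω) {α : Acceptance X} (hα : α.Sat fun n => (ω n).state) :
    ∀ᶠ n in atTop, (ω n).state ∈ accStates N α := by
  obtain ⟨E, h1, h2, h3⟩ := exists_endComponent hp hf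
  obtain ⟨k, hk⟩ := eventually_atTop.1 h2
  have hE : E.IsAccepting α := by
    refine ⟨fun n => ω (n + k), fun n => ?_, fun t ht => ?_, ?_⟩
    · have := hk (n + k) (by omega)
      simp only [transitionAt] at this ⊢
      rwa [show n + 1 + k = n + k + 1 by omega]
    · have := (frequently_add_iff k).2 (h3 t ht)
      refine this.mono fun n hn => ?_
      simp only [transitionAt] at hn ⊢
      rwa [show n + 1 + k = n + k + 1 by omega]
    · exact (α.sat_congr (infSet_shift (fun n => (ω n).state) k)).2 hα
  filter_upwards [h2] with n hn
  exact ⟨E, hE, hn.1⟩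

variable [Finite X] [Finite Act]

theorem Strategy.ae_fairPath (σ : N.Strategy) : ∀ᵐ ω ∂σ.pathMeasure, N.FairPath ω := by
  have hX : Countable X := inferInstance
  refine ae_all_iff.2 fun x => ae_all_iff.2 fun s => ?_
  by_cases hs : s ∈ (N.P x.state x.action).support
  · have h := σ.ae_frequently_succ (fun n => {ω | ω n = x})
      (fun n ω ω' he hω => (he n le_rfl).symm.trans hω) {y | y.state = s}
      (N.P x.state x.action s) hs (fun n ω hω => by
        rw [toMeasure_nextStep_state]
        have hω' : ω n = x := hω
        rw [hω'])
    filter_upwards [h] with ω hω _ hx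
    exact hω hx
  · exact Eventually.of_forall fun ω h => absurd h hs

/-! ### Potentials and bounds on the acceptance probability -/

theorem Strategy.lintegral_potential_mono (σ : N.Strategy) (φ : X → ENNReal)
    (hφ : ∀ x, ∀ a ∈ N.act x, φ x ≤ ∑' y, N.P x a y * φ y) (n : ℕ) :
    φ N.init ≤ ∫⁻ ω, φ (ω n).state ∂σ.pathMeasure := by
  induction n with
  | zero =>
    have h : ∫⁻ ω, φ (ω 0).state ∂σ.pathMeasure = ∫⁻ _, φ N.init ∂σ.pathMeasure := by
      refine lintegral_congr_ae ?_
      filter_upwards [σ.ae_zero] with ω hω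
      rw [hω.1]
    rw [h]
    simp
  | succ n ih =>
    refine ih.trans ?_
    rw [σ.lintegral_succ n fun _ y => φ y.state]
    refine lintegral_mono_ae ?_
    filter_upwards [σ.ae_isPath] with ω hω
    rw [lintegral_toMeasure_map, map_state_nextStep]
    exact hφ _ _ (hω.2 n).1

/-- A bounded potential that vanishes on the accepting end-components and does not decrease in
expectation bounds the probability of acceptance under every strategy. -/
theorem Strategy.measure_sat_add_potential_le (σ : N.Strategy) (α : Acceptance X)
    (φ : X → ENNReal) (h1 : ∀ x, φ x ≤ 1) (h0 : ∀ x ∈ accStates N α, φ x = 0)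
    (hφ : ∀ x, ∀ a ∈ N.act x, φ x ≤ ∑' y, N.P x a y * φ y) :
    σ.pathMeasure {ω | α.Sat fun n => (ω n).state} ≤ 1 - φ N.init := by
  classical
  set G := accStates N α
  -- Almost every accepting path is eventually confined to `G`, that is, lies in some `B k`. At time
  -- `k` the expected potential is at least `φ N.init`, and only states outside `G` contribute to
  -- it.
  let B : ℕ → Set (ℕ → Step X Act) := fun k => {ω | ∀ n, k ≤ n → (ω n).state ∈ G}
  have hBm : Monotone B := fun i j hij ω hω n hn => hω n (hij.trans hn)
  have hG : ∀ n, MeasurableSet {ω : ℕ → Step X Act | (ω n).state ∈ G} := fun n =>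
    (MeasurableSet.of_discrete (s := {x : Step X Act | x.state ∈ G})).preimage
      (measurable_pi_apply n)
  have hBle : ∀ k, σ.pathMeasure (B k) ≤ 1 - φ N.init := by
    intro k
    have hle : φ N.init ≤ σ.pathMeasure {ω | (ω k).state ∈ G}ᶜ := by
      refine (σ.lintegral_potential_mono φ hφ k).trans ?_
      rw [← lintegral_indicator_one (hG k).compl]
      refine lintegral_mono fun ω => ?_
      by_cases hω : (ω k).state ∈ G
      · simp [h0 _ hω]
      · rw [Set.indicator_of_mem (show ω ∈ {ω : ℕ → Step X Act | (ω k).state ∈ G}ᶜ from hω)]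
        exact h1 _
    calc σ.pathMeasure (B k) ≤ σ.pathMeasure {ω | (ω k).state ∈ G} :=
          measure_mono fun ω hω => hω k le_rfl
      _ ≤ 1 - φ N.init := by
          rw [prob_compl_eq_one_sub (hG k)] at hle
          exact ENNReal.le_sub_of_add_le_right ((h1 _).trans_lt ENNReal.one_lt_top).ne
            ((add_le_add_right hle _).trans (add_tsub_cancel_of_le prob_le_one).le)
  calc σ.pathMeasure {ω | α.Sat fun n => (ω n).state} ≤ σ.pathMeasure (⋃ k, B k) := by
        refine measure_mono_ae ?_
        filter_upwards [σ.ae_isPath, σ.ae_fairPath] with ω hp hf hα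
        obtain ⟨k, hk⟩ := eventually_atTop.1 (eventually_mem_accStates hp hf hα)
        exact Set.mem_iUnion.2 ⟨k, hk⟩
    _ ≤ 1 - φ N.init := by
        rw [hBm.measure_iUnion]
        exact iSup_le hBle

end MDP

/-! ### Almost sure winning regions -/

namespace MDP

variable {AP X Act : Type} {N : MDP AP X Act}

/-- `T` can be reached from the state by actions that cannot leave `W`. -/
inductive SafeReach (N : MDP AP X Act) (W T : Set X) : X → Prop
  | target {x : X} : x ∈ T → SafeReach N W T x
  | step {x : X} {a : Act} {y : X} : a ∈ N.act x → (N.P x a).support ⊆ W →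
      y ∈ (N.P x a).support → SafeReach N W T y → SafeReach N W T x

/-- If the supremum of the acceptance probabilities is `1`, then the initial state belongs to a
region from each of whose states an accepting end-component can be reached without the risk of
leaving the region. -/
theorem exists_region_of_iSup_eq_one [Finite X] [Finite Act] (α : Acceptance X)
    (h : ⨆ σ : N.Strategy, σ.pathMeasure {ω | α.Sat fun n => (ω n).state} = 1) :
    ∃ W : Set X, N.init ∈ W ∧ ∀ x ∈ W, SafeReach N W (accStates N α) x := by
  classical
  let Valid : (X → ENNReal) → Prop := fun φ => (∀ x, φ x ≤ 1) ∧ (∀ x ∈ accStates N α, φ x = 0) ∧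
    ∀ x, ∀ a ∈ N.act x, φ x ≤ ∑' y, N.P x a y * φ y
  have hinit : ∀ φ, Valid φ → φ N.init = 0 := by
    intro φ ⟨h1, h0, hs⟩
    have hle : (1 : ENNReal) ≤ 1 - φ N.init :=
      h.symm.le.trans (iSup_le fun σ => σ.measure_sat_add_potential_le α φ h1 h0 hs)
    by_contra hne
    exact absurd hle (not_le.2 (ENNReal.sub_lt_self ENNReal.one_ne_top one_ne_zero hne))
  -- The region is a minimal zero set of a valid potential. If some of its states could not safely
  -- reach an AEC, the potential could be raised on these states, contradicting minimality.
  have hex : ∃ φ, Valid φ ∧ ∀ ψ, Valid ψ → ¬ ({x | ψ x = 0} ⊂ {x | φ x = 0}) := by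
    obtain ⟨Z, ⟨φ, hφ, rfl⟩, hmin⟩ := Set.Finite.exists_minimal
      (s := {Z : Set X | ∃ φ, Valid φ ∧ Z = {x | φ x = 0}}) (Set.toFinite _)
      ⟨_, fun _ => 0, ⟨fun _ => zero_le_one, fun _ _ => rfl, fun _ _ _ => zero_le⟩, rfl⟩
    exact ⟨φ, hφ, fun ψ hψ hlt => hlt.2 (hmin ⟨ψ, hψ, rfl⟩ hlt.1)⟩
  obtain ⟨φ, hφ, hmin⟩ := hex
  set W : Set X := {x | φ x = 0} with hW
  refine ⟨W, hinit φ hφ, ?_⟩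
  by_contra hU
  push Not at hU
  obtain ⟨u, huW, hu⟩ := hU
  let U : Set X := {x | x ∈ W ∧ ¬ SafeReach N W (accStates N α) x}
  -- `δ` is a positive lower bound, at most 1, of all nonzero one-step expectations of `φ`; it
  -- becomes the new potential on `U`.
  obtain ⟨δ, hδ0, hδ1, hδ⟩ : ∃ δ : ENNReal, δ ≠ 0 ∧ δ ≤ 1 ∧
      ∀ x a, ∑' y, N.P x a y * φ y ≠ 0 → δ ≤ ∑' y, N.P x a y * φ y := by
    let f : X × Act → ENNReal := fun z =>
      if ∑' y, N.P z.1 z.2 y * φ y = 0 then 1 else ∑' y, N.P z.1 z.2 y * φ y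
    obtain ⟨a⟩ : Nonempty Act := ⟨(N.act_nonempty u).some⟩
    obtain ⟨z, -, hz⟩ := Set.exists_min_image Set.univ f Set.finite_univ ⟨(u, a), trivial⟩
    refine ⟨min 1 (f z), ?_, min_le_left _ _, fun x b hb => ?_⟩
    · have : f z ≠ 0 := by
        simp only [f]
        split_ifs with h0
        · exact one_ne_zero
        · exact h0
      rcases min_choice 1 (f z) with h | h <;> rw [h]
      · exact one_ne_zero
      · exact this
    · refine (min_le_right _ _).trans ((hz (x, b) trivial).trans_eq ?_)
      simp only [f]
      rw [if_neg hb]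
  let ψ : X → ENNReal := fun x => if x ∈ U then δ else φ x
  have hφψ : ∀ x, φ x ≤ ψ x := by
    intro x
    simp only [ψ]
    split_ifs with hx
    · rw [show φ x = 0 from hx.1]
      exact zero_le
    · exact le_rfl
  have hmono : ∀ x a, ∑' y, N.P x a y * φ y ≤ ∑' y, N.P x a y * ψ y := fun x a =>
    ENNReal.tsum_le_tsum fun y => mul_le_mul_right (hφψ y) _
  have hψ : Valid ψ := by
    refine ⟨fun x => ?_, fun x hx => ?_, fun x a ha => ?_⟩
    · simp only [ψ]
      split_ifs
      exacts [hδ1, hφ.1 x]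
    · have : x ∉ U := fun hU => hU.2 (.target hx)
      simp only [ψ, if_neg this]
      exact hφ.2.1 x hx
    · by_cases hx : x ∈ U
      · have e : ψ x = δ := if_pos hx
        rw [e]
        -- If the expectation vanishes, all successors lie in `W`, and then in `U`, since otherwise
        -- `x` could reach the target safely. The expectation of `ψ` is then exactly `δ`.
        by_cases h0 : ∑' y, N.P x a y * φ y = 0
        · have hsub : (N.P x a).support ⊆ W := by
            intro y hy
            have := ENNReal.tsum_eq_zero.1 h0 y
            exact (mul_eq_zero.1 this).resolve_left hy
          have hsubU : ∀ y ∈ (N.P x a).support, y ∈ U := fun y hy =>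
            ⟨hsub hy, fun hr => hx.2 (.step ha hsub hy hr)⟩
          have : ∀ y, N.P x a y * ψ y = N.P x a y * δ := by
            intro y
            by_cases hy : y ∈ (N.P x a).support
            · simp only [ψ, if_pos (hsubU y hy)]
            · rw [(PMF.apply_eq_zero_iff _ _).2 hy, zero_mul, zero_mul]
          rw [tsum_congr this, ENNReal.tsum_mul_right, PMF.tsum_coe, one_mul]
        · exact (hδ x a h0).trans (hmono x a)
      · have e : ψ x = φ x := if_neg hx
        rw [e]
        exact (hφ.2.2 x a ha).trans (hmono x a)
  refine hmin ψ hψ ⟨fun x hx => le_antisymm ((hφψ x).trans_eq hx) zero_le, fun hsub => ?_⟩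
  have h1 : ψ u = 0 := hsub huW
  have h2 : ψ u = δ := if_pos ⟨huW, hu⟩
  exact hδ0 (h2.symm.trans h1)

theorem SafeReach.of_endComponent (E : EndComponent N) {x t : X} (hx : x ∈ E.states)
    (ht : t ∈ E.states) : SafeReach N E.states {t} x := by
  induction E.connected x hx t ht using Relation.ReflTransGen.head_induction_on with
  | refl => exact .target rfl
  | head h _ ih =>
    obtain ⟨hx', a, ha, hy⟩ := h
    exact .step (E.acts_subset _ hx' ha) (E.closed _ hx' a ha) hy (ih (E.closed _ hx' a ha hy))

end MDP

/-! ### Winning surely on generic base paths -/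

/-- Every finite path of the graph `e` from a vertex that `π` visits infinitely often occurs
infinitely often in `π`. -/
def Generic {S : Type} (e : S → S → Prop) (π : ℕ → S) : Prop :=
  ∀ s u, (∃ᶠ n in atTop, π n = s) → List.IsChain e (s :: u) →
    ∃ᶠ n in atTop, π n = s ∧ ∀ i (h : i < u.length), π (n + 1 + i) = u[i]

theorem Generic.shift {S : Type} {e : S → S → Prop} {π : ℕ → S} (h : Generic e π) (k : ℕ) :
    Generic e fun n => π (n + k) := by
  intro s u hs hu
  have h1 := h s u ((frequently_add_iff (p := fun n => π n = s) k).1 hs) hu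
  refine ((frequently_add_iff k).2 h1).mono fun n hn => ⟨hn.1, fun i hi => ?_⟩
  rw [← hn.2 i hi]
  exact congrArg π (by omega)

namespace MDP

variable {AP X Act S : Type} {N : MDP AP X Act}

/-- Successors in `N` are determined by their image under `f`, and the images of transitions of
`N` are edges of `e`. -/
structure IsBaseMap (N : MDP AP X Act) (f : X → S) (e : S → S → Prop) : Prop where
  inj : ∀ x, ∀ a ∈ N.act x, ∀ y ∈ (N.P x a).support, ∀ y' ∈ (N.P x a).support, f y = f y' → y = y'
  edge : ∀ x, ∀ a ∈ N.act x, ∀ y ∈ (N.P x a).support, e (f x) (f y)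

/-- Under the memoryless strategy `c`, the state `x` is driven into `T` if the base path follows
the word `u`. -/
def Drives (N : MDP AP X Act) (c : X → Act) (f : X → S) (T : Set X) : List S → X → Prop
  | [], x => x ∈ T
  | s :: u, x => x ∈ T ∨ ∀ y ∈ (N.P x (c x)).support, f y = s → Drives N c f T u y

theorem Drives.of_mem {c : X → Act} {f : X → S} {T : Set X} {x : X} (h : x ∈ T) (u : List S) :
    Drives N c f T u x := by
  cases u with
  | nil => exact h
  | cons s u => exact Or.inl h

theorem Drives.append {c : X → Act} {f : X → S} {T : Set X} {u : List S} {x : X}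
    (h : Drives N c f T u x) (v : List S) : Drives N c f T (u ++ v) x := by
  induction u generalizing x with
  | nil => exact .of_mem h v
  | cons s u ih =>
    rcases h with h | h
    · exact Or.inl h
    · exact Or.inr fun y hy hs => ih (h y hy hs)

theorem Drives.exists_mem {c : X → Act} {f : X → S} {T : Set X} {u : List S} {x : ℕ → X} {n : ℕ}
    (h : Drives N c f T u (x n)) (hx : ∀ m ≥ n, x (m + 1) ∈ (N.P (x m) (c (x m))).support)
    (hu : ∀ i (h : i < u.length), f (x (n + 1 + i)) = u[i]) : ∃ m ≥ n, x m ∈ T := by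
  induction u generalizing n with
  | nil => exact ⟨n, le_rfl, h⟩
  | cons s u ih =>
    rcases h with h | h
    · exact ⟨n, le_rfl, h⟩
    · have h1 := h (x (n + 1)) (hx n le_rfl) (hu 0 (by simp))
      obtain ⟨m, hm, hT⟩ := ih h1 (fun m hm => hx m (by omega)) fun i hi => by
        have := hu (i + 1) (by simpa using hi)
        rw [show n + 1 + 1 + i = n + 1 + (i + 1) by omega, this]
        simp
      exact ⟨m, by omega, hT⟩

/-- The states from which `T` is reachable in at most `n` steps by `W`-safe actions. -/
def safeLevel (N : MDP AP X Act) (W T : Set X) : ℕ → Set X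
  | 0 => T
  | n + 1 => {x | x ∈ safeLevel N W T n ∨ ∃ a ∈ N.act x, (N.P x a).support ⊆ W ∧
      ∃ y ∈ (N.P x a).support, y ∈ safeLevel N W T n}

theorem safeLevel_mono (W T : Set X) : Monotone (safeLevel N W T) :=
  monotone_nat_of_le_succ fun _ _ h => Or.inl h

theorem SafeReach.exists_level {W T : Set X} {x : X} (h : SafeReach N W T x) :
    ∃ n, x ∈ safeLevel N W T n := by
  induction h with
  | target h => exact ⟨0, h⟩
  | step ha hW hy _ ih =>
    obtain ⟨n, hn⟩ := ih
    exact ⟨n + 1, Or.inr ⟨_, ha, hW, _, hy, hn⟩⟩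

/-- An attractor strategy: `c x` is safe and has a successor of smaller least level. The base states
of these successors spell a word that drives `x` into `T`, because successors are determined by
their base states. -/
theorem exists_positional {f : X → S} {e : S → S → Prop} (hf : N.IsBaseMap f e) {W T : Set X}
    (hW : ∀ x ∈ W, SafeReach N W T x) :
    ∃ c : X → Act, (∀ x, c x ∈ N.act x) ∧ (∀ x ∈ W, x ∉ T → (N.P x (c x)).support ⊆ W) ∧
      ∀ x ∈ W, ∃ u, List.IsChain e (f x :: u) ∧ Drives N c f T u x := by
  have hc : ∀ x, ∃ a ∈ N.act x, x ∈ W → x ∉ T → (N.P x a).support ⊆ W ∧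
      ∃ y ∈ (N.P x a).support, ∀ n, x ∈ safeLevel N W T (n + 1) → y ∈ safeLevel N W T n := by
    classical
    intro x
    by_cases hx : x ∈ W ∧ x ∉ T
    · have hex := (hW x hx.1).exists_level
      have hmem := Nat.find_spec hex
      have hmin := fun m => Nat.find_min' hex (m := m)
      generalize Nat.find hex = k at hmem hmin
      cases k with
      | zero => exact absurd hmem hx.2
      | succ k =>
        rcases hmem with h | ⟨a, ha, hs, y, hy, hk⟩
        · exact absurd (hmin k h) (by omega)
        · refine ⟨a, ha, fun _ _ => ⟨hs, y, hy, fun n hn => ?_⟩⟩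
          exact safeLevel_mono W T (by have := hmin (n + 1) hn; omega) hk
    · obtain ⟨a, ha⟩ := N.act_nonempty x
      exact ⟨a, ha, fun h1 h2 => absurd ⟨h1, h2⟩ hx⟩
  choose c hca hc using hc
  refine ⟨c, hca, fun x h1 h2 => (hc x h1 h2).1, ?_⟩
  have key : ∀ n, ∀ x ∈ W, x ∈ safeLevel N W T n →
      ∃ u, List.IsChain e (f x :: u) ∧ Drives N c f T u x := by
    intro n
    induction n with
    | zero => exact fun x _ hT => ⟨[], List.isChain_singleton _, hT⟩
    | succ n ih =>
      intro x hxW hx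
      by_cases hT : x ∈ T
      · exact ⟨[], List.isChain_singleton _, hT⟩
      · obtain ⟨hs, y, hy, hl⟩ := hc x hxW hT
        obtain ⟨u, hu, hd⟩ := ih y (hs hy) (hl n hx)
        refine ⟨f y :: u, List.isChain_cons_cons.2 ⟨hf.edge x _ (hca x) y hy, hu⟩, Or.inr ?_⟩
        intro y' hy' he
        rwa [hf.inj x _ (hca x) y' hy' y hy he]
  intro x hx
  obtain ⟨n, hn⟩ := (hW x hx).exists_level
  exact key n x hx hn

/-- Along a base word the strategy `c` has at most one play from `x`. Unless this play meets `T` or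
cannot follow `u`, it ends in a single state `y ∈ W`, and words for `y` can be appended to `u`. -/
theorem drives_or_exists_end {f : X → S} {e : S → S → Prop} (hf : N.IsBaseMap f e) {W T : Set X}
    {c : X → Act} (hca : ∀ x, c x ∈ N.act x)
    (hcW : ∀ x ∈ W, x ∉ T → (N.P x (c x)).support ⊆ W) (u : List S) {x : X} (hx : x ∈ W)
    (hu : List.IsChain e (f x :: u)) :
    Drives N c f T u x ∨ ∃ y ∈ W, ∀ v, List.IsChain e (f y :: v) →
      List.IsChain e (f x :: (u ++ v)) ∧ (Drives N c f T v y → Drives N c f T (u ++ v) x) := by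
  induction u generalizing x with
  | nil => exact Or.inr ⟨x, hx, fun v hv => ⟨hv, id⟩⟩
  | cons s u ih =>
    by_cases hT : x ∈ T
    · exact Or.inl (Or.inl hT)
    by_cases hy : ∃ y ∈ (N.P x (c x)).support, f y = s
    · obtain ⟨y, hy, rfl⟩ := hy
      obtain ⟨hxy, hu⟩ := List.isChain_cons_cons.1 hu
      have huniq : ∀ y' ∈ (N.P x (c x)).support, f y' = f y → y' = y := fun y' hy' he =>
        hf.inj x _ (hca x) y' hy' y hy he
      rcases ih (hcW x hx hT hy) hu with h | ⟨z, hz, h⟩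
      · exact Or.inl (Or.inr fun y' hy' he => huniq y' hy' he ▸ h)
      · refine Or.inr ⟨z, hz, fun v hv => ⟨List.isChain_cons_cons.2 ⟨hxy, (h v hv).1⟩, fun hd => ?_⟩⟩
        exact Or.inr fun y' hy' he => huniq y' hy' he ▸ (h v hv).2 hd
    -- No successor lies over `s`, so the word drives `x` vacuously. This happens when the base word
    -- leaves the pruned chain.
    · push Not at hy
      exact Or.inl (Or.inr fun y hy' he => absurd he (hy y hy'))

/-- A synchronizing word: it drives all states of `W` over the base state `s` into `T`. -/
theorem exists_word [Finite X] {f : X → S} {e : S → S → Prop} (hf : N.IsBaseMap f e) {W T : Set X}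
    {c : X → Act} (hca : ∀ x, c x ∈ N.act x)
    (hcW : ∀ x ∈ W, x ∉ T → (N.P x (c x)).support ⊆ W)
    (hW : ∀ x ∈ W, ∃ u, List.IsChain e (f x :: u) ∧ Drives N c f T u x) (s : S) :
    ∃ u, List.IsChain e (s :: u) ∧ ∀ x ∈ W, f x = s → Drives N c f T u x := by
  -- The states are treated one after another: appending a word for the next state does not disturb
  -- the states already driven into `T`.
  have key : ∀ K : Set X, K.Finite →
      ∃ u, List.IsChain e (s :: u) ∧ ∀ x ∈ K, x ∈ W → f x = s → Drives N c f T u x := by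
    intro K hK
    induction K, hK using Set.Finite.induction_on with
    | empty => exact ⟨[], List.isChain_singleton _, fun x hx => absurd hx (Set.notMem_empty x)⟩
    | @insert x K _ _ ih =>
      obtain ⟨u, hu, hK⟩ := ih
      have huse : ∀ v, List.IsChain e (s :: (u ++ v)) →
          (x ∈ W → f x = s → Drives N c f T (u ++ v) x) →
          ∃ u, List.IsChain e (s :: u) ∧ ∀ y ∈ insert x K, y ∈ W → f y = s → Drives N c f T u y := by
        intro v hv hx
        refine ⟨u ++ v, hv, ?_⟩
        rintro y (rfl | hy) h1 h2
        · exact hx h1 h2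
        · exact (hK y hy h1 h2).append v
      by_cases hx : x ∈ W ∧ f x = s
      · obtain ⟨hxW, rfl⟩ := hx
        rcases drives_or_exists_end hf hca hcW u hxW hu with h | ⟨y, hy, h⟩
        · exact huse [] (by simpa using hu) fun _ _ => h.append []
        · obtain ⟨v, hv, hd⟩ := hW y hy
          exact huse v (h v hv).1 fun _ _ => (h v hv).2 hd
      · exact huse [] (by simpa using hu) fun h1 h2 => absurd ⟨h1, h2⟩ hx
  obtain ⟨u, hu, h⟩ := key Set.univ Set.finite_univ
  exact ⟨u, hu, fun x => h x trivial⟩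

/-- Genericity concerns the base path only, so a word tailored to one state over `s` might be read
while the play is in another. A synchronizing word for a recurrent base state works wherever in `W`
the play is. -/
theorem exists_mem_target [Finite X] {f : X → S} {e : S → S → Prop} (hf : N.IsBaseMap f e)
    {W T : Set X} {c : X → Act} (hca : ∀ x, c x ∈ N.act x)
    (hcW : ∀ x ∈ W, x ∉ T → (N.P x (c x)).support ⊆ W)
    (hW : ∀ x ∈ W, ∃ u, List.IsChain e (f x :: u) ∧ Drives N c f T u x) {x : ℕ → X}
    (hg : Generic e (f ∘ x)) {k : ℕ} (hxW : ∀ n ≥ k, x n ∈ W)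
    (hx : ∀ n ≥ k, x (n + 1) ∈ (N.P (x n) (c (x n))).support) : ∃ n ≥ k, x n ∈ T := by
  obtain ⟨z, hz⟩ := infSet_nonempty x
  obtain ⟨u, hu, hd⟩ := exists_word hf hca hcW hW (f z)
  have h := hg (f z) u (Frequently.mono hz fun n hn => congrArg f hn) hu
  obtain ⟨n, hn, h1, h2⟩ := frequently_atTop.1 h k
  obtain ⟨m, hm, hT⟩ := (hd (x n) (hxW n hn) h1).exists_mem (fun m hm => hx m (hn.trans hm)) h2
  exact ⟨m, hn.trans hm, hT⟩

/-- A strategy with memory `Φ` that in each phase heads for a target set and then changes the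
phase. -/
structure PhaseStrategy (N : MDP AP X Act) (Φ : Type) where
  init : Φ
  move : Φ → X → Act
  next : Φ → X → Φ
  enabled : ∀ p x, move p x ∈ N.act x

/-- The state sequence `x` together with the memory sequence `p` is a play of the strategy. -/
structure PhaseStrategy.IsPlay {Φ : Type} (τ : PhaseStrategy N Φ) (p : ℕ → Φ) (x : ℕ → X) :
    Prop where
  zero : p 0 = τ.init
  next : ∀ n, p (n + 1) = τ.next (p n) (x n)
  step : ∀ n, x (n + 1) ∈ (N.P (x n) (τ.move (p n) (x n))).support

/-- Each phase plays its own positional strategy until its target is hit, then changes by `nx`. A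
phase that lasted forever would contradict `exists_mem_target`. -/
theorem exists_phaseStrategy [Finite X] {f : X → S} {e : S → S → Prop} (hf : N.IsBaseMap f e)
    {Φ : Type} (p₀ : Φ) (W T : Φ → Set X) (nx : Φ → X → Φ)
    (hW : ∀ p, ∀ x ∈ W p, SafeReach N (W p) (T p) x)
    (hT : ∀ p, ∀ x ∈ W p, x ∈ T p → ∃ a ∈ N.act x, (N.P x a).support ⊆ W (nx p x)) :
    ∃ τ : PhaseStrategy N Φ, ∀ p x, τ.IsPlay p x → x 0 ∈ W p₀ → Generic e (f ∘ x) →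
      p 0 = p₀ ∧ (∀ n, x n ∈ W (p n)) ∧ (∃ᶠ n in atTop, x n ∈ T (p n)) ∧
      (∀ n, x n ∈ T (p n) → p (n + 1) = nx (p n) (x n)) ∧
      ∀ n, x n ∉ T (p n) → p (n + 1) = p n := by
  classical
  choose c hca hcW hcd using fun p => exists_positional hf (hW p)
  have hd : ∀ p x, ∃ a ∈ N.act x, x ∈ W p → x ∈ T p → (N.P x a).support ⊆ W (nx p x) := by
    intro p x
    by_cases h : x ∈ W p ∧ x ∈ T p
    · obtain ⟨a, ha, h⟩ := hT p x h.1 h.2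
      exact ⟨a, ha, fun _ _ => h⟩
    · obtain ⟨a, ha⟩ := N.act_nonempty x
      exact ⟨a, ha, fun h1 h2 => absurd ⟨h1, h2⟩ h⟩
  choose d hda hdW using hd
  let τ : PhaseStrategy N Φ :=
    { init := p₀
      move := fun p x => if x ∈ T p then d p x else c p x
      next := fun p x => if x ∈ T p then nx p x else p
      enabled := fun p x => by
        split_ifs
        exacts [hda p x, hca p x] }
  refine ⟨τ, fun p x hplay h0 hg => ?_⟩
  have hn1 : ∀ n, x n ∈ T (p n) → p (n + 1) = nx (p n) (x n) := fun n hn =>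
    (hplay.next n).trans (if_pos hn)
  have hn2 : ∀ n, x n ∉ T (p n) → p (n + 1) = p n := fun n hn =>
    (hplay.next n).trans (if_neg hn)
  have hm1 : ∀ n, x n ∈ T (p n) → x (n + 1) ∈ (N.P (x n) (d (p n) (x n))).support := fun n hn => by
    have := hplay.step n
    rwa [show τ.move (p n) (x n) = d (p n) (x n) from if_pos hn] at this
  have hm2 : ∀ n, x n ∉ T (p n) → x (n + 1) ∈ (N.P (x n) (c (p n) (x n))).support := fun n hn => by
    have := hplay.step n
    rwa [show τ.move (p n) (x n) = c (p n) (x n) from if_neg hn] at this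
  have hxW : ∀ n, x n ∈ W (p n) := by
    intro n
    induction n with
    | zero =>
      rw [hplay.zero]
      exact h0
    | succ n ih =>
      by_cases hn : x n ∈ T (p n)
      · rw [hn1 n hn]
        exact hdW _ _ ih hn (hm1 n hn)
      · rw [hn2 n hn]
        exact hcW _ _ ih hn (hm2 n hn)
  refine ⟨hplay.zero, hxW, ?_, hn1, hn2⟩
  by_contra hc
  rw [not_frequently, eventually_atTop] at hc
  obtain ⟨k, hk⟩ := hc
  have hp : ∀ n ≥ k, p n = p k := by
    intro n hn
    induction n, hn using Nat.le_induction with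
    | base => rfl
    | succ n hn ih => rw [hn2 n (hk n hn), ih]
  obtain ⟨n, hn, hT⟩ := exists_mem_target hf (hca (p k)) (hcW (p k)) (hcd (p k)) hg (k := k)
    (fun n hn => hp n hn ▸ hxW n) (fun n hn => hp n hn ▸ hm2 n (hk n hn))
  exact hk n hn (hp n hn ▸ hT)

/-- The phases: `none` while heading for an accepting end-component, then `some (E, i)` while
heading in the end-component `E` for the `i`-th item of an enumeration of its states. -/
abbrev Phase (N : MDP AP X Act) : Type := Option (EndComponent N × ℕ)

/-- After entering an AEC `E`, the strategy stays in `E.states` and visits each of them infinitely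
often. Actions outside `E.acts` may be used, but acceptance depends on the states alone. -/
theorem exists_winning_phaseStrategy [Finite X] {f : X → S} {e : S → S → Prop}
    (hf : N.IsBaseMap f e) (α : Acceptance X) {W : Set X}
    (hW : ∀ x ∈ W, SafeReach N W (accStates N α) x) :
    ∃ τ : PhaseStrategy N (Phase N), ∀ p x, τ.IsPlay p x → x 0 ∈ W → Generic e (f ∘ x) →
      α.Sat x := by
  classical
  have hg : ∀ E : EndComponent N, ∃ g : ℕ → X, (∀ i, g i ∈ E.states) ∧
      ∀ t ∈ E.states, ∃ᶠ i in atTop, g i = t := by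
    intro E
    obtain ⟨g, hg⟩ := (Set.to_countable E.states).exists_eq_range E.nonempty
    -- Unpairing the index makes every item of the enumeration recur infinitely often.
    refine ⟨fun i => g i.unpair.1, fun i => hg ▸ Set.mem_range_self _, fun t ht => ?_⟩
    rw [hg] at ht
    obtain ⟨j, rfl⟩ := ht
    refine frequently_atTop.2 fun a => ⟨Nat.pair j a, Nat.right_le_pair j a, ?_⟩
    simp
  choose g hgE hg using hg
  have hE : ∀ x, ∃ E : Option (EndComponent N), x ∈ accStates N α →
      ∃ E', E = some E' ∧ E'.IsAccepting α ∧ x ∈ E'.states := by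
    intro x
    by_cases hx : x ∈ accStates N α
    · obtain ⟨E, h1, h2⟩ := hx
      exact ⟨some E, fun _ => ⟨E, rfl, h1, h2⟩⟩
    · exact ⟨none, fun h => absurd h hx⟩
  choose F hF using hE
  let Wp : Phase N → Set X := fun p => match p with
    | none => W
    | some (E, _) => E.states
  let Tp : Phase N → Set X := fun p => match p with
    | none => accStates N α
    | some (E, i) => {g E i}
  let nx : Phase N → X → Phase N := fun p x => match p with
    | none => (F x).map fun E => (E, 0)
    | some (E, i) => some (E, i + 1)
  obtain ⟨τ, hτ⟩ := exists_phaseStrategy hf none Wp Tp nx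
    (by
      rintro (_ | ⟨E, i⟩) x hx
      · exact hW x hx
      · exact .of_endComponent E hx (hgE E i))
    (by
      rintro (_ | ⟨E, i⟩) x hx hT
      · obtain ⟨E, h1, -, h2⟩ := hF x hT
        obtain ⟨a, ha⟩ := E.acts_nonempty x h2
        refine ⟨a, E.acts_subset x h2 ha, ?_⟩
        simp only [nx, h1, Option.map_some, Wp]
        exact E.closed x h2 a ha
      · obtain ⟨a, ha⟩ := E.acts_nonempty x hx
        exact ⟨a, E.acts_subset x hx ha, E.closed x hx a ha⟩)
  refine ⟨τ, fun p x hplay h0 hgen => ?_⟩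
  obtain ⟨hp0, hxW, hfr, hn1, hn2⟩ := hτ p x hplay h0 hgen
  obtain ⟨k, hk, hkT⟩ : ∃ k, (∀ n ≤ k, p n = none) ∧ x k ∈ Tp (p k) := by
    have hex := hfr.exists
    refine ⟨Nat.find hex, fun n hn => ?_, Nat.find_spec hex⟩
    induction n with
    | zero => exact hp0
    | succ n ih =>
      rw [hn2 n (Nat.find_min hex (by omega)), ih (by omega)]
  have hkG : x k ∈ accStates N α := by
    rw [hk k le_rfl] at hkT
    exact hkT
  obtain ⟨E, h1, hacc, -⟩ := hF (x k) hkG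
  have hk1 : p (k + 1) = some (E, 0) := by
    rw [hn1 k hkT, hk k le_rfl]
    simp only [nx, h1, Option.map_some]
  have hphase : ∀ n, ∃ i, p (n + (k + 1)) = some (E, i) := by
    intro n
    induction n with
    | zero => exact ⟨0, by rw [Nat.zero_add, hk1]⟩
    | succ n ih =>
      obtain ⟨i, hi⟩ := ih
      rw [show n + 1 + (k + 1) = n + (k + 1) + 1 by omega]
      by_cases hT : x (n + (k + 1)) ∈ Tp (p (n + (k + 1)))
      · exact ⟨i + 1, by rw [hn1 _ hT, hi]⟩
      · exact ⟨i, by rw [hn2 _ hT, hi]⟩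
  -- The bound `i ≤ n` turns infinitely many indices of a state into infinitely many visits.
  have hhit : ∀ i, ∃ n, p (n + (k + 1)) = some (E, i) ∧ i ≤ n ∧ x (n + (k + 1)) = g E i := by
    have hex : ∀ m, ∃ n ≥ m, x (n + (k + 1)) ∈ Tp (p (n + (k + 1))) := by
      intro m
      obtain ⟨b, hb, h⟩ := frequently_atTop.1 hfr (m + (k + 1))
      exact ⟨b - (k + 1), by omega, by rwa [Nat.sub_add_cancel (by omega)]⟩
    have hnext : ∀ i m, i ≤ m → p (m + (k + 1)) = some (E, i) →
        ∃ n ≥ m, p (n + (k + 1)) = some (E, i) ∧ x (n + (k + 1)) = g E i := by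
      intro i m _ hm
      have hex' := hex m
      have hsp := Nat.find_spec hex'
      have hconst : ∀ n ≥ m, n ≤ Nat.find hex' → p (n + (k + 1)) = some (E, i) := by
        intro n hn
        induction n, hn using Nat.le_induction with
        | base => exact fun _ => hm
        | succ n hn ih =>
          intro hle
          have hnT : x (n + (k + 1)) ∉ Tp (p (n + (k + 1))) := fun hc =>
            Nat.find_min hex' (m := n) (by omega) ⟨hn, hc⟩
          rw [show n + 1 + (k + 1) = n + (k + 1) + 1 by omega, hn2 _ hnT]
          exact ih (by omega)
      have hc := hconst _ hsp.1 le_rfl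
      refine ⟨_, hsp.1, hc, ?_⟩
      have := hsp.2
      rw [hc] at this
      exact this
    intro i
    induction i with
    | zero =>
      obtain ⟨n, hn, h1, h2⟩ := hnext 0 0 le_rfl (by rw [Nat.zero_add, hk1])
      exact ⟨n, h1, hn, h2⟩
    | succ i ih =>
      obtain ⟨m, hm, him, hx⟩ := ih
      have hmT : x (m + (k + 1)) ∈ Tp (p (m + (k + 1))) := by
        rw [hm]
        exact hx
      have h3 : p (m + 1 + (k + 1)) = some (E, i + 1) := by
        rw [show m + 1 + (k + 1) = m + (k + 1) + 1 by omega, hn1 _ hmT, hm]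
      obtain ⟨n, hn, h1, h2⟩ := hnext (i + 1) (m + 1) (by omega) h3
      exact ⟨n, h1, by omega, h2⟩
  refine hacc.sat ?_
  rw [← infSet_shift x (k + 1)]
  ext t
  constructor
  · intro ht
    obtain ⟨n, rfl⟩ := Frequently.exists ht
    obtain ⟨i, hi⟩ := hphase n
    have := hxW (n + (k + 1))
    rw [hi] at this
    exact this
  · intro ht
    refine frequently_atTop.2 fun a => ?_
    obtain ⟨i, hi, rfl⟩ := frequently_atTop.1 (hg E t ht) a
    obtain ⟨n, -, hin, hx⟩ := hhit i
    exact ⟨n, hi.trans hin, hx⟩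

end MDP

/-! ### Markov chains -/

theorem Generic.frequently_of_reflTransGen {S : Type} {e : S → S → Prop} {π : ℕ → S}
    (h : Generic e π) {s t : S} (hst : Relation.ReflTransGen e s t)
    (hs : ∃ᶠ n in atTop, π n = s) : ∃ᶠ n in atTop, π n = t := by
  induction hst with
  | refl => exact hs
  | @tail b c _ hbc ih =>
    have h1 := h b [c] ih (by simpa using hbc)
    exact (frequently_add_iff (p := fun n => π n = c) 1).1
      (h1.mono fun n hn => hn.2 0 (by simp))

namespace MDP

variable {AP X Act : Type} {N : MDP AP X Act}

/-- The graph of the possible transitions between states. -/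
def Edge (N : MDP AP X Act) (s t : X) : Prop := ∃ a ∈ N.act s, t ∈ (N.P s a).support

/-- Induction on the word from its right end: whenever all but the last letter has been read, the
last one follows with a fixed positive probability, because the action is forced. -/
theorem Strategy.ae_generic [Finite X] [Finite Act] (hN : N.IsMarkovChain) (σ : N.Strategy) :
    ∀ᵐ ω ∂σ.pathMeasure, Generic N.Edge fun n => (ω n).state := by
  have key : ∀ s : X, ∀ u : List X, ∀ᵐ ω ∂σ.pathMeasure, List.IsChain N.Edge (s :: u) →
      (∃ᶠ n in atTop, (ω n).state = s) → ∃ᶠ n in atTop, (ω n).state = s ∧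
        ∀ i (h : i < u.length), (ω (n + 1 + i)).state = u[i] := by
    intro s u
    induction u using List.reverseRecOn with
    | nil => exact Eventually.of_forall fun ω _ hs => hs.mono fun n hn => ⟨hn, fun i hi => by simp at hi⟩
    | append_singleton u t ih =>
      by_cases hu : List.IsChain N.Edge (s :: (u ++ [t]))
      swap
      · exact Eventually.of_forall fun ω h => absurd h hu
      rw [← List.cons_append, List.isChain_append] at hu
      obtain ⟨hu, -, hl⟩ := hu
      set l := (s :: u).getLast (by simp) with hldef
      obtain ⟨a, ha, ht⟩ : N.Edge l t := hl l (by simp [hldef, List.getLast?_eq_getLast_of_ne_nil]) t (by simp)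
      -- At time `n` the word `s :: u` has just been completed and its last state `l` is current.
      let D : ℕ → Set (ℕ → Step X Act) := fun n => {ω | u.length ≤ n ∧ ω n = ⟨l, a⟩ ∧
        (ω (n - u.length)).state = s ∧
          ∀ i (h : i < u.length), (ω (n - u.length + 1 + i)).state = u[i]}
      have hD : ∀ n, DependsUpTo n (D n) := by
        rintro n ω ω' he ⟨h0, h1, h2, h3⟩
        refine ⟨h0, by rw [← he n le_rfl, h1], by rw [← he _ (by omega), h2], fun i hi => ?_⟩
        rw [← he _ (by omega), h3 i hi]
      have h := σ.ae_frequently_succ D hD {y | y.state = t} (N.P l a t) ht (fun n ω hω => by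
        rw [toMeasure_nextStep_state, hω.2.1])
      filter_upwards [h, ih, σ.ae_isPath] with ω h hi hp _ hs
      have hlast : ∀ m, (ω m).state = s →
          (∀ i (h : i < u.length), (ω (m + 1 + i)).state = u[i]) →
          (ω (m + u.length)).state = l := by
        intro m h1 h2
        rcases u.eq_nil_or_concat with rfl | ⟨v, b, rfl⟩
        · simpa [hldef] using h1
        · have := h2 v.length (by simp)
          rw [show m + (v.concat b).length = m + 1 + v.length by simp; omega, this]
          simp [hldef]
      have hfr : ∃ᶠ n in atTop, ω ∈ D n := by
        refine (frequently_add_iff u.length).1 ((hi hu hs).mono ?_)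
        rintro m ⟨h1, h2⟩
        have hl := hlast m h1 h2
        have hact := (hp.2 (m + u.length)).1
        rw [hl] at hact
        refine ⟨by omega, ?_, by simpa using h1, fun i hi => ?_⟩
        · rw [← hl, (hN l).unique ha hact]
        · rw [← h2 i hi]
          simp
      refine ((frequently_add_iff u.length).2 (h hfr)).mono ?_
      rintro m ⟨⟨-, -, h1, h2⟩, h3⟩
      simp only [Nat.add_sub_cancel] at h1 h2
      refine ⟨h1, fun i hi => ?_⟩
      by_cases hiu : i < u.length
      · rw [h2 i hiu, List.getElem_append_left hiu]
      · have : i = u.length := by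
          simp at hi
          omega
        subst this
        rw [show m + 1 + u.length = m + u.length + 1 by omega]
        simpa using h3
  have : Countable X := inferInstance
  filter_upwards [ae_all_iff.2 fun s => ae_all_iff.2 (key s)] with ω hω s u hs hu
  exact hω s u hu hs

instance : Nonempty N.Strategy :=
  ⟨{ choice := fun _ s => PMF.pure (N.act_nonempty s).some
     enabled := fun _ s a ha => by
      rw [PMF.support_pure, Set.mem_singleton_iff] at ha
      exact ha ▸ (N.act_nonempty s).some_mem }⟩

/-! ### Products and the pruned subset construction -/

variable {S Q : Type} {M : MDP AP S Act} {A : Automaton AP Q}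

theorem mem_support_product {x : S × Q} {b : Act × Q} {y : S × Q} :
    y ∈ ((M.product A).P x b).support ↔ y.1 ∈ (M.P x.1 b.1).support ∧ y.2 = b.2 := by
  obtain ⟨s, q⟩ := y
  simp only [product, PMF.support_map, Set.mem_image, Prod.mk.injEq]
  constructor
  · rintro ⟨s', h, rfl, rfl⟩
    exact ⟨h, rfl⟩
  · rintro ⟨h, rfl⟩
    exact ⟨s, h, rfl, rfl⟩

theorem isBaseMap_product {Z : Type} {f : S → Z} {e : Z → Z → Prop} (hf : M.IsBaseMap f e) :
    (M.product A).IsBaseMap (f ∘ Prod.fst) e where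
  inj := by
    intro x b hb y hy y' hy' h
    rw [mem_support_product] at hy hy'
    exact Prod.ext (hf.inj _ _ hb.1 _ hy.1 _ hy'.1 h) (hy.2.trans hy'.2.symm)
  edge := by
    intro x b hb y hy
    exact hf.edge _ _ hb.1 _ (mem_support_product.1 hy).1

theorem isBaseMap_id : M.IsBaseMap id M.Edge where
  inj := fun _ _ _ _ _ _ _ h => h
  edge := fun _ a ha _ hy => ⟨a, ha, hy⟩

/-- The successor of the pair `x` in the subset construction, if the next state is `s`. -/
def trackNext (M : MDP AP S Act) (A : Automaton AP Q) (x : S × Set Q) (s : S) : S × Set Q :=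
  (s, {q' | ∃ q ∈ x.2, q' ∈ A.δ q (M.label x.1)})

/-- The pairs that contain a state of an accepting end-component of the product. -/
def goodPairs (M : MDP AP S Act) (A : Automaton AP Q) : Set (S × Set Q) :=
  {x | ∃ q ∈ x.2, (x.1, q) ∈ accStates (M.product A) (prodAcc S A)}

def TrackEdge (M : MDP AP S Act) (A : Automaton AP Q) (x y : S × Set Q) : Prop :=
  M.Edge x.1 y.1 ∧ y = M.trackNext A x y.1

/-- The pairs from which a good pair can be reached. -/
def promising (M : MDP AP S Act) (A : Automaton AP Q) : Set (S × Set Q) :=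
  {x | ∃ y ∈ M.goodPairs A, Relation.ReflTransGen (M.TrackEdge A) x y}

open Classical in
/-- `M` together with the subset construction of `A`, restricted to the promising pairs. -/
def pruned (M : MDP AP S Act) (A : Automaton AP Q) : MDP AP (S × Set Q) Act where
  init := (M.init, {A.init})
  act x := M.act x.1
  act_nonempty x := M.act_nonempty x.1
  P x a :=
    -- Conditioning needs a promising successor. For a Markov chain the `else` branch is a mere
    -- default, never used by an enabled action of a promising pair.
    if h : ∃ y ∈ M.promising A, y ∈ ((M.P x.1 a).map (M.trackNext A x)).support then
      ((M.P x.1 a).map (M.trackNext A x)).filter (M.promising A) h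
    else (M.P x.1 a).map (M.trackNext A x)
  label x := M.label x.1

theorem mem_support_map_trackNext {x y : S × Set Q} {a : Act} :
    y ∈ ((M.P x.1 a).map (M.trackNext A x)).support ↔
      y.1 ∈ (M.P x.1 a).support ∧ y = M.trackNext A x y.1 := by
  simp only [PMF.support_map, Set.mem_image]
  constructor
  · rintro ⟨s, hs, rfl⟩
    exact ⟨hs, rfl⟩
  · rintro ⟨h1, h2⟩
    exact ⟨y.1, h1, h2.symm⟩

theorem of_mem_support_pruned {x y : S × Set Q} {a : Act}
    (h : y ∈ ((M.pruned A).P x a).support) :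
    y.1 ∈ (M.P x.1 a).support ∧ y = M.trackNext A x y.1 := by
  rw [← mem_support_map_trackNext]
  simp only [pruned] at h
  split_ifs at h
  · exact ((PMF.mem_support_filter_iff _).1 h).2
  · exact h

theorem mem_support_pruned {x y : S × Set Q} {a : Act} (hy : y ∈ M.promising A)
    (h1 : y.1 ∈ (M.P x.1 a).support) (h2 : y = M.trackNext A x y.1) :
    y ∈ ((M.pruned A).P x a).support := by
  have h := mem_support_map_trackNext.2 ⟨h1, h2⟩
  simp only [pruned]
  rw [dif_pos ⟨y, hy, h⟩]
  exact (PMF.mem_support_filter_iff _).2 ⟨hy, h⟩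

/-- An action of the end-component carries the only base action of `M`, so the component contains a
successor over every next state of `M`. -/
theorem trackNext_mem_goodPairs (hM : M.IsMarkovChain) {x : S × Set Q} (hx : x ∈ M.goodPairs A)
    {a : Act} (ha : a ∈ M.act x.1) {s : S} (hs : s ∈ (M.P x.1 a).support) :
    M.trackNext A x s ∈ M.goodPairs A := by
  obtain ⟨q, hq, E, hE, hqE⟩ := hx
  obtain ⟨b, hb⟩ := E.acts_nonempty _ hqE
  have hb' := E.acts_subset _ hqE hb
  refine ⟨b.2, ⟨q, hq, hb'.2⟩, E, hE, E.closed _ hqE b hb (mem_support_product.2 ⟨?_, rfl⟩)⟩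
  rw [(hM _).unique hb'.1 ha]
  exact hs

theorem goodPairs_subset_promising : M.goodPairs A ⊆ M.promising A := fun x hx =>
  ⟨x, hx, .refl⟩

/-- A promising successor to condition on exists: the next pair on a path to a good pair, or any
successor if the pair is already good. -/
theorem promising_of_support (hM : M.IsMarkovChain) {x y : S × Set Q} (hx : x ∈ M.promising A)
    {a : Act} (ha : a ∈ M.act x.1) (hy : y ∈ ((M.pruned A).P x a).support) :
    y ∈ M.promising A := by
  have hex : ∃ y ∈ M.promising A, y ∈ ((M.P x.1 a).map (M.trackNext A x)).support := by
    obtain ⟨z, hz, hxz⟩ := hx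
    rcases hxz.cases_head with rfl | ⟨w, ⟨⟨b, hb, hw⟩, hw'⟩, hwz⟩
    · obtain ⟨s, hs⟩ := (M.P x.1 a).support_nonempty
      exact ⟨_, goodPairs_subset_promising (trackNext_mem_goodPairs hM hz ha hs),
        mem_support_map_trackNext.2 ⟨hs, rfl⟩⟩
    · refine ⟨w, ⟨z, hz, hwz⟩, mem_support_map_trackNext.2 ⟨?_, hw'⟩⟩
      rwa [(hM _).unique ha hb]
  simp only [pruned] at hy
  rw [dif_pos hex] at hy
  exact ((PMF.mem_support_filter_iff _).1 hy).1

theorem isBaseMap_pruned : (M.pruned A).IsBaseMap Prod.fst M.Edge where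
  inj := by
    intro x a ha y hy y' hy' h
    rw [(of_mem_support_pruned hy).2, (of_mem_support_pruned hy').2, h]
  edge := fun x a ha y hy => ⟨a, ha, (of_mem_support_pruned hy).1⟩

theorem reflTransGen_pruned {x y : S × Set Q} (hy : y ∈ M.goodPairs A)
    (h : Relation.ReflTransGen (M.TrackEdge A) x y) :
    Relation.ReflTransGen (M.pruned A).Edge x y := by
  induction h using Relation.ReflTransGen.head_induction_on with
  | refl => exact .refl
  | head h h' ih =>
    obtain ⟨⟨a, ha, hs⟩, he⟩ := h
    exact ih.head ⟨a, ha, mem_support_pruned ⟨y, hy, h'⟩ hs he⟩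

theorem exists_lift_pruned (hM : M.IsMarkovChain) (u : List S) {x : S × Set Q}
    (hx : x ∈ M.goodPairs A) (hu : List.IsChain M.Edge (x.1 :: u)) :
    ∃ v : List (S × Set Q), List.IsChain (M.pruned A).Edge (x :: v) ∧ v.map Prod.fst = u := by
  induction u generalizing x with
  | nil => exact ⟨[], List.isChain_singleton _, rfl⟩
  | cons s u ih =>
    obtain ⟨⟨a, ha, hs⟩, hu⟩ := List.isChain_cons_cons.1 hu
    have hg := trackNext_mem_goodPairs hM hx ha hs
    obtain ⟨v, hv, rfl⟩ := ih hg hu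
    exact ⟨M.trackNext A x s :: v, List.isChain_cons_cons.2 ⟨⟨a, ha, mem_support_pruned
      (goodPairs_subset_promising hg) hs rfl⟩, hv⟩, rfl⟩

theorem exists_run_prefix {x : ℕ → S × Set Q} (h0 : (x 0).2 = {A.init})
    (hx : ∀ n, x (n + 1) = M.trackNext A (x n) (x (n + 1)).1) (n : ℕ) {q : Q} (hq : q ∈ (x n).2) :
    ∃ ρ : ℕ → Q, ρ 0 = A.init ∧ (∀ i < n, ρ (i + 1) ∈ A.δ (ρ i) (M.label (x i).1)) ∧ ρ n = q := by
  induction n generalizing q with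
  | zero =>
    rw [h0, Set.mem_singleton_iff] at hq
    exact ⟨fun _ => q, hq, fun i hi => absurd hi (by omega), rfl⟩
  | succ n ih =>
    rw [hx n] at hq
    obtain ⟨q', hq', hδ⟩ := hq
    obtain ⟨ρ, h0, h1, h2⟩ := ih hq'
    refine ⟨fun i => if i ≤ n then ρ i else q, by simpa using h0, fun i hi => ?_, by simp⟩
    by_cases hin : i = n
    · subst hin
      simpa [h2] using hδ
    · have := h1 i (by omega)
      simpa [show i ≤ n by omega, show i + 1 ≤ n by omega] using this

/-- Genericity forces a visit to a good pair, and good pairs are never left. They lose no successors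
by pruning, so from then on the base path is generic for the whole of `M`. A run of `A` into the AEC
is continued there by the winning phase strategy on `M × A`. -/
theorem trace_pruned_mem_language [Finite S] [Finite Q] (hM : M.IsMarkovChain)
    (hinit : (M.pruned A).init ∈ M.promising A) {ω : ℕ → Step (S × Set Q) Act}
    (hp : (M.pruned A).IsPath ω) (hg : Generic (M.pruned A).Edge fun n => (ω n).state) :
    (M.pruned A).trace ω ∈ A.language := by
  set x : ℕ → S × Set Q := fun n => (ω n).state with hxdef
  have hstep : ∀ n, (x (n + 1)).1 ∈ (M.P (x n).1 (ω n).action).support ∧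
      x (n + 1) = M.trackNext A (x n) (x (n + 1)).1 := fun n => of_mem_support_pruned (hp.2 n).2
  have hact : ∀ n, (ω n).action ∈ M.act (x n).1 := fun n => (hp.2 n).1
  have hprom : ∀ n, x n ∈ M.promising A := by
    intro n
    induction n with
    | zero =>
      rw [hxdef]
      simp only [hp.1]
      exact hinit
    | succ n ih => exact promising_of_support hM ih (hact n) (hp.2 n).2
  obtain ⟨k, hk⟩ : ∃ k, x k ∈ M.goodPairs A := by
    obtain ⟨z, hz⟩ := infSet_nonempty x
    obtain ⟨n, hn⟩ := Frequently.exists hz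
    obtain ⟨y, hy, hzy⟩ := hprom n
    rw [hn] at hzy
    obtain ⟨k, hk⟩ := (hg.frequently_of_reflTransGen (reflTransGen_pruned hy hzy) hz).exists
    exact ⟨k, hk ▸ hy⟩
  have hgood : ∀ n, x (n + k) ∈ M.goodPairs A := by
    intro n
    induction n with
    | zero => rwa [Nat.zero_add]
    | succ n ih =>
      rw [show n + 1 + k = n + k + 1 by omega, (hstep (n + k)).2]
      exact trackNext_mem_goodPairs hM ih (hact _) (hstep (n + k)).1
  have hgen : Generic M.Edge fun n => (x (n + k)).1 := by
    intro s u hs hu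
    have hs' : s ∈ infSet (Prod.fst ∘ fun n => x (n + k)) := hs
    rw [infSet_comp] at hs'
    obtain ⟨z, hz, rfl⟩ := hs'
    obtain ⟨n, hn⟩ := Frequently.exists hz
    obtain ⟨v, hv, rfl⟩ := exists_lift_pruned hM u (show z ∈ M.goodPairs A from hn ▸ hgood n) hu
    refine (hg.shift k z v hz hv).mono fun m hm => ⟨congrArg Prod.fst hm.1, fun i hi => ?_⟩
    rw [List.getElem_map]
    exact congrArg Prod.fst (hm.2 i (by simpa using hi))
  obtain ⟨q, hq, hqE⟩ := hk
  obtain ⟨ρ, hρ0, hρ, hρk⟩ := exists_run_prefix (M := M) (A := A) (x := x)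
    (by rw [hxdef]; simp only [hp.1]; rfl) (fun n => (hstep n).2) k hq
  obtain ⟨τ, hτ⟩ := exists_winning_phaseStrategy (isBaseMap_product (A := A) (isBaseMap_id (M := M)))
    (prodAcc S A) (W := accStates (M.product A) (prodAcc S A)) (fun y hy => .target hy)
  -- The strategy is run along the given base path; the second component is the resulting run of `A`
  -- from `q`.
  let mem : ℕ → Phase (M.product A) × Q := fun n => Nat.rec (τ.init, q)
    (fun n m => (τ.next m.1 ((x (n + k)).1, m.2), (τ.move m.1 ((x (n + k)).1, m.2)).2)) n
  let y : ℕ → S × Q := fun n => ((x (n + k)).1, (mem n).2)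
  have hen : ∀ n, τ.move (mem n).1 (y n) ∈ (M.product A).act (y n) := fun n => τ.enabled _ _
  have hplay : τ.IsPlay (fun n => (mem n).1) y :=
    { zero := rfl
      next := fun n => rfl
      step := fun n => by
        refine mem_support_product.2 ⟨?_, rfl⟩
        have h1 := (hstep (n + k)).1
        rw [(hM _).unique (hact (n + k)) (hen n).1] at h1
        simp only [y]
        rwa [show n + 1 + k = n + k + 1 by omega] }
  have hsat := hτ _ y hplay (by simpa [y, mem] using hqE) hgen
  rw [prodAcc, Acceptance.sat_comap] at hsat
  refine ⟨fun n => if n < k then ρ n else (mem (n - k)).2, ⟨?_, fun n => ?_⟩, ?_⟩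
  · by_cases h : 0 < k
    · simpa [h] using hρ0
    · have h0 : k = 0 := by omega
      subst h0
      simpa [mem] using hρk.symm.trans hρ0
  · rw [show (M.pruned A).trace ω n = M.label (x n).1 from rfl]
    by_cases h1 : n + 1 < k
    · simpa [h1, show n < k by omega] using hρ n (by omega)
    · by_cases h2 : n < k
      · have h3 : k = n + 1 := by omega
        subst h3
        have := hρ n (by omega)
        rw [hρk] at this
        simpa [mem] using this
      · have := (hen (n - k)).2
        simp only [y, Nat.sub_add_cancel (not_lt.1 h2)] at this
        simp only [h1, h2, if_false]
        rw [show n + 1 - k = n - k + 1 by omega]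
        simp only [mem, Nat.sub_add_cancel (not_lt.1 h2)]
        exact this
  · refine (A.acc.sat_congr ?_).1 hsat
    rw [← infSet_shift (fun n => if n < k then ρ n else (mem (n - k)).2) k]
    congr 1
    funext n
    simp [y]

theorem Psem_pruned_eq_one [Finite S] [Finite Act] [Finite Q] (hM : M.IsMarkovChain)
    (hinit : (M.pruned A).init ∈ M.promising A) : Psem (M.pruned A) A = 1 := by
  refine le_antisymm (iSup_le fun σ => prob_le_one) ?_
  obtain ⟨σ⟩ : Nonempty (M.pruned A).Strategy := inferInstance
  refine le_trans ?_ (le_iSup _ σ)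
  rw [← measure_univ (μ := σ.pathMeasure)]
  refine measure_mono_ae ?_
  have hc : (M.pruned A).IsMarkovChain := fun x => hM x.1
  filter_upwards [σ.ae_isPath, σ.ae_generic hc] with ω hp hg _
  exact trace_pruned_mem_language hM hinit hp hg

end MDP

/-! ### The simulation strategy -/

namespace MDP

variable {AP S Act QA QB : Type} {M : MDP AP S Act} {A : Automaton AP QA} {B : Automaton AP QB}

theorem exists_lift_endComponent (hM : M.IsMarkovChain) (E : EndComponent (M.product A))
    (u : List S) {z : S × QA} (hz : z ∈ E.states) (hu : List.IsChain M.Edge (z.1 :: u)) :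
    ∃ L : List (Transition (S × QA) (Act × QA)), (∀ t ∈ L, t ∈ E.transitions) ∧
      (L.IsChain fun t t' => t.2.2 = t'.1) ∧ (∀ t ∈ L.head?, t.1 = z) ∧
      L.map (fun t => t.2.2.1) = u := by
  induction u generalizing z with
  | nil => exact ⟨[], by simp, List.isChain_nil, by simp, rfl⟩
  | cons s u ih =>
    obtain ⟨⟨a, ha, hs⟩, hu⟩ := List.isChain_cons_cons.1 hu
    obtain ⟨b, hb⟩ := E.acts_nonempty z hz
    rw [(hM z.1).unique ha (E.acts_subset z hz hb).1] at hs
    have hy : (s, b.2) ∈ ((M.product A).P z b).support := mem_support_product.2 ⟨hs, rfl⟩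
    obtain ⟨L, h1, h2, h3, rfl⟩ := ih (E.closed z hz b hb hy) hu
    refine ⟨(z, b, (s, b.2)) :: L, ?_, ?_, by simp, rfl⟩
    · rintro t ht
      rcases List.mem_cons.1 ht with rfl | ht
      · exact ⟨hz, hb, hy⟩
      · exact h1 t ht
    · exact List.isChain_cons.2 ⟨fun t ht => (h3 t ht).symm, h2⟩

/-- Each base word lifts to a sequence of transitions of `E`, which recurs by compliance. -/
theorem generic_of_infSequences [Finite S] [Finite QA] [Finite Act] (hM : M.IsMarkovChain)
    {E : EndComponent (M.product A)} {ξ : ℕ → Step (S × QA) (Act × QA)}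
    (hξ : infSequences ξ = E.sequences) : Generic M.Edge fun n => (ξ n).state.1 := by
  intro s u hs hu
  cases u with
  | nil => exact hs.mono fun n hn => ⟨hn, fun i hi => by simp at hi⟩
  | cons s' u =>
    have hs' : ∃ᶠ n in atTop, ∃ b : Transition (S × QA) (Act × QA), transitionAt ξ n = b ∧ b.1.1 = s :=
      hs.mono fun n hn => ⟨_, rfl, hn⟩
    -- A recurrent transition out of a state over `s` is a one-element sequence on the list. Its
    -- source is therefore a state of `E` from which the word can be lifted.
    obtain ⟨b, hb⟩ := frequently_exists_of_finite hs'
    obtain ⟨-, -, hbs⟩ := hb.exists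
    have hbE : [b] ∈ E.sequences := by
      rw [← hξ]
      refine hb.mono fun n hn i hi => ?_
      have : i = 0 := by simpa using hi
      subst this
      simpa using hn.1.symm
    have hz : b.1 ∈ E.states := (hbE.1 b (by simp)).1
    obtain ⟨L, h1, h2, h3, h4⟩ := exists_lift_endComponent hM E (s' :: u) hz (hbs ▸ hu)
    have hL : L ∈ infSequences ξ := hξ ▸ ⟨h1, h2⟩
    have hlen : L.length = (s' :: u).length := by rw [← h4, List.length_map]
    refine Frequently.mono hL fun n hn => ⟨?_, fun i hi => ?_⟩
    · have h0 : 0 < L.length := by simp [hlen]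
      have h5 := hn 0 h0
      have h6 := h3 L[0] (by simp [List.head?_eq_getElem?, h0])
      rw [h5] at h6
      rw [← hbs, ← h6]
      rfl
    · have h5 := hn i (hlen ▸ hi)
      simp only [← h4, List.getElem_map]
      rw [h5]
      simp only [transitionAt]
      rw [show n + 1 + i = n + i + 1 by omega]

/-- The sets of states of the automaton that are reachable on the prefixes of the word. -/
def reachSets (A : Automaton AP QA) (w : ℕ → Set AP) : ℕ → Set QA
  | 0 => {A.init}
  | n + 1 => {q' | ∃ q ∈ reachSets A w n, q' ∈ A.δ q (w n)}

theorem IsPath.edge {ξ : ℕ → Step (S × QA) (Act × QA)} (hξ : (M.product A).IsPath ξ) (n : ℕ) :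
    M.Edge (ξ n).state.1 (ξ (n + 1)).state.1 :=
  ⟨_, (hξ.2 n).1.1, (mem_support_product.1 (hξ.2 n).2).1⟩

theorem IsPath.mem_reachSets {ξ : ℕ → Step (S × QA) (Act × QA)} (hξ : (M.product A).IsPath ξ)
    (n : ℕ) : (ξ n).state.2 ∈ reachSets A (fun n => M.label (ξ n).state.1) n := by
  induction n with
  | zero =>
    rw [hξ.1]
    rfl
  | succ n ih =>
    refine ⟨_, ih, ?_⟩
    rw [(mem_support_product.1 (hξ.2 n).2).2]
    exact (hξ.2 n).1.2

/-- A path of `M × A` that visits an accepting end-component projects to promising pairs only. -/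
theorem IsPath.mem_promising (hM : M.IsMarkovChain) {ξ : ℕ → Step (S × QA) (Act × QA)}
    (hξ : (M.product A).IsPath ξ) {k : ℕ}
    (hk : (ξ k).state ∈ accStates (M.product A) (prodAcc S A)) (n : ℕ) :
    ((ξ n).state.1, reachSets A (fun n => M.label (ξ n).state.1) n) ∈ M.promising A := by
  set x : ℕ → S × Set QA := fun n =>
    ((ξ n).state.1, reachSets A (fun n => M.label (ξ n).state.1) n)
  have hx : ∀ n, M.TrackEdge A (x n) (x (n + 1)) := fun n => ⟨hξ.edge n, rfl⟩
  have hxk : x k ∈ M.goodPairs A := ⟨_, hξ.mem_reachSets k, hk⟩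
  rcases le_total n k with h | h
  · refine ⟨x k, hxk, ?_⟩
    induction k, h using Nat.le_induction with
    | base => exact .refl
    | succ m h ih =>
      clear ih hk hxk
      induction m, h using Nat.le_induction with
      | base => exact .single (hx n)
      | succ m h ih => exact ih.tail (hx (m + 1))
  · refine goodPairs_subset_promising ?_
    change x n ∈ _
    induction n, h using Nat.le_induction with
    | base => exact hxk
    | succ n h ih =>
      obtain ⟨⟨a, ha, hs⟩, he⟩ := hx n
      rw [he]
      exact trackNext_mem_goodPairs hM ih ha hs

/-- One step of the memory of the simulation strategy: the phase, the subset construction of `A`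
and the state of `B`. -/
def memoryStep (τ : PhaseStrategy ((M.pruned A).product B) (Phase ((M.pruned A).product B)))
    (m : Phase ((M.pruned A).product B) × Set QA × QB) (s : S) :
    Phase ((M.pruned A).product B) × Set QA × QB :=
  (τ.next m.1 ((s, m.2.1), m.2.2), (M.trackNext A (s, m.2.1) s).2,
    (τ.move m.1 ((s, m.2.1), m.2.2)).2)

/-- The memory of the simulation strategy after the base path `l`. -/
def memory (τ : PhaseStrategy ((M.pruned A).product B) (Phase ((M.pruned A).product B)))
    (l : List S) : Phase ((M.pruned A).product B) × Set QA × QB :=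
  l.foldl (memoryStep τ) (τ.init, {A.init}, B.init)

open Classical in
/-- The strategy on `M × B` that plays the automaton moves prescribed by `τ`. -/
def simulation (τ : PhaseStrategy ((M.pruned A).product B) (Phase ((M.pruned A).product B))) :
    (M.product B).Strategy where
  choice h z :=
    -- The memory has already read the current state, so its `B`-component is the successor to be
    -- chosen. The fallback only ensures enabledness on histories that do not follow the strategy.
    let b := ((M.act_nonempty z.1).some, (memory τ (h.map (fun y => y.state.1) ++ [z.1])).2.2)
    PMF.pure (if b ∈ (M.product B).act z then b else ((M.product B).act_nonempty z).some)
  enabled h z b hb := by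
    rw [PMF.support_pure, Set.mem_singleton_iff] at hb
    rw [hb]
    split_ifs with h
    · exact h
    · exact ((M.product B).act_nonempty z).some_mem

end MDP

/-! ### Correctness of the simulation strategy -/

namespace MDP

variable {AP S Act QA QB : Type} {M : MDP AP S Act} {A : Automaton AP QA} {B : Automaton AP QB}

theorem memory_concat (τ : PhaseStrategy ((M.pruned A).product B) (Phase ((M.pruned A).product B)))
    (l : List S) (s : S) : memory τ (l ++ [s]) = memoryStep τ (memory τ l) s := by
  simp [memory]

/-- While the pairs remain promising, every step of `ζ`, with the subset construction attached, is a
possible step of `M.pruned A × B`. Thus `ζ` lifts to a play of `τ` with the same `B`-states. -/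
theorem acceptingPath_of_consistent [Finite S] [Finite QA] [Finite QB] (hM : M.IsMarkovChain)
    {τ : PhaseStrategy ((M.pruned A).product B) (Phase ((M.pruned A).product B))}
    {W : Set ((S × Set QA) × QB)} (hW : ((M.pruned A).product B).init ∈ W)
    (hτ : ∀ p x, τ.IsPlay p x → x 0 ∈ W →
      Generic M.Edge (Prod.fst ∘ Prod.fst ∘ x) → (prodAcc (S × Set QA) B).Sat x)
    {ζ : ℕ → Step (S × QB) (Act × QB)} (hζ : (M.product B).IsPath ζ)
    (hc : (simulation τ).Consistent ζ) (hg : Generic M.Edge fun n => (ζ n).state.1)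
    (hprom : ∀ n, ((ζ n).state.1, reachSets A (fun n => M.label (ζ n).state.1) n) ∈
      M.promising A) : AcceptingPath B ζ := by
  set π : ℕ → S := fun n => (ζ n).state.1 with hπ
  set R : ℕ → Set QA := reachSets A (fun n => M.label (ζ n).state.1) with hR
  let m := fun n => memory τ (List.ofFn fun i : Fin n => π i)
  have hm : ∀ n, m (n + 1) = memoryStep τ (m n) (π n) := fun n => by
    simp only [m]
    rw [List.ofFn_succ', List.concat_eq_append, memory_concat]
    simp
  have hmR : ∀ n, (m n).2.1 = R n := by
    intro n
    induction n with
    | zero => rfl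
    | succ n ih =>
      rw [hm n]
      simp only [memoryStep, ih]
      rfl
  have hmq : ∀ n, (m n).2.2 = (ζ n).state.2 := by
    intro n
    induction n with
    | zero =>
      rw [hζ.1]
      rfl
    | succ n ih =>
      have h1 := hc n
      have hlist : (List.ofFn fun i : Fin n => ζ i).map (fun y => y.state.1) ++ [(ζ n).state.1] =
          List.ofFn fun i : Fin (n + 1) => π i := by
        rw [List.ofFn_succ', List.concat_eq_append, List.map_ofFn]
        rfl
      have hb : ((M.act_nonempty (ζ n).state.1).some, (m (n + 1)).2.2) ∈
          (M.product B).act (ζ n).state := by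
        refine ⟨(M.act_nonempty (ζ n).state.1).some_mem, ?_⟩
        have h2 := (τ.enabled (m n).1 ((π n, (m n).2.1), (m n).2.2)).2
        rw [hm n]
        simp only [ih] at h2
        simp only [memoryStep, ih]
        exact h2
      simp only [simulation, PMF.support_pure, Set.mem_singleton_iff] at h1
      split_ifs at h1 with hb'
      · rw [(mem_support_product.1 (hζ.2 n).2).2, h1, hlist]
      · rw [hlist] at hb'
        exact absurd hb hb'
  let x : ℕ → (S × Set QA) × QB := fun n => ((π n, R n), (ζ n).state.2)
  have hmx : ∀ n, ((π n, (m n).2.1), (m n).2.2) = x n := fun n => by rw [hmR, hmq]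
  have hplay : τ.IsPlay (fun n => (m n).1) x :=
    { zero := rfl
      next := fun n => by
        rw [hm n, ← hmx]
        rfl
      step := fun n => by
        have hen := (τ.enabled (m n).1 (x n)).1
        refine mem_support_product.2 ⟨mem_support_pruned (hprom (n + 1)) ?_ rfl, ?_⟩
        · obtain ⟨a, ha, hs⟩ := hζ.edge n
          rw [(hM _).unique ha hen] at hs
          exact hs
        · change (ζ (n + 1)).state.2 = _
          rw [← hmq, hm n, ← hmx]
          rfl }
  have h0 : x 0 ∈ W := by
    have : x 0 = ((M.pruned A).product B).init := by
      simp only [x, hπ, hR, hζ.1]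
      rfl
    rwa [this]
  have hsat := hτ _ x hplay h0 hg
  rw [prodAcc, Acceptance.sat_comap] at hsat
  rw [AcceptingPath, prodAcc, Acceptance.sat_comap]
  exact hsat

/-- Equality of languages transfers semantic probability 1 from `A` to `B`; goodness of `B` on the
pruned chain makes it syntactic. -/
theorem exists_region_pruned [Finite S] [Finite Act] [Finite QA] [Finite QB]
    (hM : M.IsMarkovChain) (hB : B.IsGFM) (hAB : A.language = B.language)
    (hinit : (M.pruned A).init ∈ M.promising A) :
    ∃ W : Set ((S × Set QA) × QB), ((M.pruned A).product B).init ∈ W ∧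
      ∀ x ∈ W, SafeReach ((M.pruned A).product B) W
        (accStates ((M.pruned A).product B) (prodAcc (S × Set QA) B)) x := by
  refine exists_region_of_iSup_eq_one _ ?_
  have h1 : Psem (M.pruned A) B = 1 := by
    rw [← Psem_pruned_eq_one hM hinit]
    simp only [Psem, hAB]
  exact (hB _ _ (M.pruned A)).symm.trans h1

end MDP
end GFM

end

theorem mainTheorem7 {AP QA QB : Type} [Finite QA] [Finite QB]
    (A : GFM.Automaton AP QA) (B : GFM.Automaton AP QB)
    (hA : A.IsGFM) (hB : B.IsGFM) (hAB : A.language = B.language)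
    {S Act : Type} [Finite S] [Finite Act] (M : GFM.MDP AP S Act) (hM : M.IsMarkovChain) :
    ∃ σ : (M.product B).Strategy, GFM.AECSimulates M A B σ := by
  by_cases hinit : (M.pruned A).init ∈ M.promising A
  · obtain ⟨W, hW, hr⟩ := GFM.MDP.exists_region_pruned hM hB hAB hinit
    obtain ⟨τ, hτ⟩ := GFM.MDP.exists_winning_phaseStrategy
      (GFM.MDP.isBaseMap_product (A := B) (GFM.MDP.isBaseMap_pruned (M := M) (A := A))) _ hr
    refine ⟨GFM.MDP.simulation τ, fun ξ claim ζ hξ hζ hbase hc => ?_⟩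
    by_cases hcl : ∃ c, claim = some c ∧ GFM.Complies ξ c
    · obtain ⟨c, -, hacc, hk, hseq⟩ := hcl
      have he : ∀ n, (ξ n).state.1 = (ζ n).state.1 := fun n => (hbase n).1.symm
      have hg := GFM.MDP.generic_of_infSequences hM hseq
      have hp := hξ.mem_promising hM ⟨c.2, hacc, hk⟩
      simp only [he] at hg hp
      exact Or.inr (Or.inl (GFM.MDP.acceptingPath_of_consistent hM hW hτ hζ hc hg hp))
    · cases claim with
      | none => exact Or.inl rfl
      | some c => exact Or.inr (Or.inr (Or.inl ⟨c, rfl, fun h => hcl ⟨c, rfl, h⟩⟩))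
  -- If the initial pair is not promising, no path of `M × A` visits an AEC. No claim can be
  -- complied with, and every strategy wins.
  · obtain ⟨σ⟩ : Nonempty (M.product B).Strategy := inferInstance
    refine ⟨σ, fun ξ claim ζ hξ hζ hbase hc => ?_⟩
    cases claim with
    | none => exact Or.inl rfl
    | some c =>
      refine Or.inr (Or.inr (Or.inl ⟨c, rfl, fun ⟨hacc, hk, hseq⟩ => hinit ?_⟩))
      have h0 := hξ.mem_promising hM ⟨c.2, hacc, hk⟩ 0
      rw [hξ.1] at h0
      exact h0
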